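/- For real $x$ let $$F(x)=\frac{e^{-i\pi/4}}{\sqrt\pi}\int_x^\infty e^{it^2}\,dt$$ (a convergent improper integral). For an integer $N\ge 1$ put $A_N=\sqrt{(N+1/2)\pi}$, $t_k=(k-1/2)\pi/A_N$, and $$F_N(x)=\frac12+\frac i2\tan\left(A_Nxe^{i\pi/4}\right)+\frac{x}{A_N}\,e^{i(x^2+\pi/4)}\sum_{k=1}^N\frac{e^{-t_k^2}}{x^2+it_k^2}.$$ Let $\beta=1-\frac{\sqrt2}{2}-\frac{2\sqrt2+1}{16}$ and, for $x\ge0$, $$\Delta_N(x)=\begin{cases}\dfrac{x\,e^{-A_N^2}}{\sqrt\pi\,(A_N^2-x^2/2)\,(1-e^{-2A_N^2})}, & 0\le \dfrac{x}{\sqrt2}\le\frac34A_N,\\[2ex] \dfrac{4x\,e^{-A_N^2}\left(1+2\sqrt\pi\,e^{-\beta A_N^2}\right)}{\sqrt\pi\,A_N\,(A_N+x/\sqrt2)\,(1-e^{-2A_N^2})}, & \frac34A_N<\dfrac{x}{\sqrt2}<\frac54A_N,\\[2ex] \dfrac{x\,e^{-A_N^2}}{\sqrt\pi\,(x^2/2-A_N^2)\,(1-e^{-2A_N^2})}+\dfrac{e^{-\sqrt2A_Nx}}{1-e^{-\sqrt2A_Nx}},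 & \dfrac{x}{\sqrt2}\ge\frac54A_N,\end{cases}$$ and, for $x\in\mathbb R$, $$\eta_N(x)=\Delta_N(|x|)+\frac{(2\pi+1)|x|}{2\pi A_N\sqrt{x^4+A_N^4}}\,e^{-A_N^2}.$$ Then, for every integer $N\ge1$ and every $x\in\mathbb R$, $$|F(x)-F_N(x)|\le\eta_N(x)\le c_N\,\frac{e^{-\pi N}}{\sqrt{N+1/2}},$$ where $$c_N=\frac{20\sqrt2\,e^{-\pi/2}}{9\pi\,(1-e^{-2A_N^2})}\left(1+2\sqrt\pi\,e^{-\beta A_N^2}\right)+\frac{(2\pi+1)\,e^{-\pi/2}}{2\sqrt2\,\pi^{3/2}A_N}.$$ The sequence $(c_N)_{N\ge1}$ is strictly decreasing, $c_1\approx0.825$, and $\lim_{N\to\infty}c_N=\dfrac{20\sqrt2\,e^{-\pi/2}}{9\pi}\approx0.208$ (both decimals correct to within $0.0005$). In particular $F_N\to F$ exponentially, uniformly on $\mathbb R$: there is a constant $C>0$ with $|F(x)-F_N(x)|\le C e^{-\pi N}$ for all $N\ge1$ and all $x\in\mathbb R$. -/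

import Mathlib

namespace Fresnel

/-- The Fresnel integral `F(x) = e^{-iπ/4}/√π ∫_x^∞ e^{it²} dt`. The integrand is not absolutely
integrable, so the integral is the improper one, the limit of `∫_x^R` as `R → ∞`. -/
noncomputable def F (x : ℝ) : ℂ :=
  Complex.exp (-(Complex.I * Real.pi / 4)) / (Real.sqrt Real.pi : ℂ) *
    Filter.limUnder Filter.atTop
      (fun R : ℝ => ∫ t in x..R, Complex.exp (Complex.I * (t : ℂ) ^ 2))

/-- `A_N = √((N + 1/2) π)`. -/
noncomputable def A (N : ℕ) : ℝ := Real.sqrt (((N : ℝ) + 1 / 2) * Real.pi)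

/-- The quadrature nodes `t_k = (k - 1/2) π / √((N + 1/2) π)`. -/
noncomputable def node (N k : ℕ) : ℝ :=
  ((k : ℝ) - 1 / 2) * Real.pi / Real.sqrt (((N : ℝ) + 1 / 2) * Real.pi)

/-- The modified trapezium rule approximation `F_N`. -/
noncomputable def FN (N : ℕ) (x : ℝ) : ℂ :=
  1 / 2 + Complex.I / 2 * Complex.tan (A N * x * Complex.exp (Complex.I * Real.pi / 4)) +
    (x : ℂ) / A N * Complex.exp (Complex.I * ((x : ℂ) ^ 2 + Real.pi / 4)) *
      ∑ k ∈ Finset.Icc 1 N,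
        Complex.exp (-(node N k : ℂ) ^ 2) / ((x : ℂ) ^ 2 + Complex.I * (node N k : ℂ) ^ 2)

/-- `β = 1 - √2/2 - (2√2 + 1)/16`. -/
noncomputable def β : ℝ := 1 - Real.sqrt 2 / 2 - (2 * Real.sqrt 2 + 1) / 16

/-- The function `Δ_h(x)`, `x ≥ 0`, for the step size `h = π / A_N`. -/
noncomputable def Δ (N : ℕ) (x : ℝ) : ℝ :=
  if x / Real.sqrt 2 ≤ 3 / 4 * A N then
    x * Real.exp (-(A N) ^ 2) /
      (Real.sqrt Real.pi * ((A N) ^ 2 - x ^ 2 / 2) * (1 - Real.exp (-2 * (A N) ^ 2)))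
  else if x / Real.sqrt 2 < 5 / 4 * A N then
    4 * x * Real.exp (-(A N) ^ 2) *
        (1 + 2 * Real.sqrt Real.pi * Real.exp (-β * (A N) ^ 2)) /
      (Real.sqrt Real.pi * A N * (A N + x / Real.sqrt 2) * (1 - Real.exp (-2 * (A N) ^ 2)))
  else
    x * Real.exp (-(A N) ^ 2) /
        (Real.sqrt Real.pi * (x ^ 2 / 2 - (A N) ^ 2) * (1 - Real.exp (-2 * (A N) ^ 2))) +
      Real.exp (-(Real.sqrt 2 * A N * x)) / (1 - Real.exp (-(Real.sqrt 2 * A N * x)))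

/-- The pointwise error bound `η_N`. -/
noncomputable def η (N : ℕ) (x : ℝ) : ℝ :=
  Δ N |x| +
    (2 * Real.pi + 1) * |x| / (2 * Real.pi * A N * Real.sqrt (x ^ 4 + (A N) ^ 4)) *
      Real.exp (-(A N) ^ 2)

/-- The constants `c_N`. -/
noncomputable def c (N : ℕ) : ℝ :=
  20 * Real.sqrt 2 * Real.exp (-Real.pi / 2) / (9 * Real.pi * (1 - Real.exp (-2 * (A N) ^ 2))) *
      (1 + 2 * Real.sqrt Real.pi * Real.exp (-β * (A N) ^ 2)) +
    (2 * Real.pi + 1) * Real.exp (-Real.pi / 2) /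
      (2 * Real.sqrt 2 * Real.pi ^ (3 / 2 : ℝ) * A N)

end Fresnel

/-!
Write `L(p) = ∫_0^∞ e^{-ps - s²/4} ds = √π e^{p²} erfc p`, an entire function (`gaussLaplace`), and
`ρ = x e^{-iπ/4}`, so that `ρ² = -ix²` and `Re ρ = a := x/√2`. Differentiating under the integral
gives `L' = 2pL - 2`, hence `e^{ix²} L(ρ)` is a primitive of `-2 e^{-iπ/4} e^{ix²}` that vanishes at
`+∞`; this proves convergence of the Fresnel integral and `F(x) = e^{ix²} L(ρ) / (2√π)` (`F_eq`).

For `x > 0` the Fourier transform of `e^{-t²}/(x² + it²)` is, up to a constant, the function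
`e^{-c²} (L(ρ - c) + L(ρ + c))` (`integral_integrand_mul_exp`), because the pole factor is itself a
Laplace transform. Poisson summation (`tsum_integrand`) then expresses the error of the midpoint
rule of step `π/A_N` as the alternating series of these values at `c = m A_N`, `m ≥ 1`. The
reflection formula `L(p) + L(-p) = 2√π e^{p²}` (`gaussLaplace_add_neg`) plays the part of the residue
theorem: it turns `L(ρ - c)` into `-L(c - ρ)` plus an exponential, and the sum of these
exponentials cancels the tangent term of `F_N`. So `F - F_N` is the truncated tail of the midpoint sum plus
a series that may be taken either with the residues (`F_sub_FN_eq`) or without them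
(`F_sub_FN_eq_poleFree`).

The three cases in `Δ` correspond to three estimates of `L`. For `a ≤ (3/4) A_N` the two terms of the
pole-free series are combined through `|sinh (u - iu)| ≤ √2 sinh u`. For `a ≥ (5/4) A_N` completing
the square bounds the other series term by term. In between, integration by parts gives
`|L(p)| ≤ 2/|p|` on the closed right half-plane, which is not affected by `Re p` being close to `0`
because `|Im ρ| = a` stays away from `0`. The claims on `c_N` reduce to elementary inequalities and to
Taylor bounds for the exponential.
-/

namespace Fresnel

open Complex MeasureTheory Set Filter Topology

/-! ### The Laplace transform of the Gaussian -/

/-- The integrand `e^{-ps - s²/4}` of `gaussLaplace`. -/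
noncomputable def gaussKernel (p : ℂ) (s : ℝ) : ℂ := Complex.exp (-p * s - (s : ℂ) ^ 2 / 4)

/-- The Laplace transform `L(p) = ∫_0^∞ e^{-ps - s²/4} ds` of the Gaussian, an entire function equal
to `√π e^{p²} erfc p`. -/
noncomputable def gaussLaplace (p : ℂ) : ℂ := ∫ s in Ioi (0 : ℝ), gaussKernel p s

lemma norm_gaussKernel (p : ℂ) (s : ℝ) : ‖gaussKernel p s‖ = Real.exp (-p.re * s - s ^ 2 / 4) := by
  rw [gaussKernel, Complex.norm_exp]
  congr 1
  have : (-p * s - (s : ℂ) ^ 2 / 4) = -p * (s : ℂ) - ((s ^ 2 / 4 : ℝ) : ℂ) := by push_cast; ring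
  rw [this, Complex.sub_re, Complex.ofReal_re, Complex.re_mul_ofReal, Complex.neg_re]

lemma continuous_gaussKernel (p : ℂ) : Continuous (gaussKernel p) := by
  unfold gaussKernel; fun_prop

lemma integrable_gaussKernel (p : ℂ) : Integrable (gaussKernel p) := by
  have h := integrable_cexp_quadratic' (b := -1 / 4) (by norm_num) (-p) 0
  refine h.congr (Eventually.of_forall fun s => ?_)
  simp only [gaussKernel]
  congr 1
  ring

lemma integrable_exp_sub_sq (b : ℝ) : Integrable fun s : ℝ => Real.exp (-b * s - s ^ 2 / 4) := by
  refine (integrable_gaussKernel (b : ℂ)).norm.congr (Eventually.of_forall fun s => ?_)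
  simp [norm_gaussKernel]

lemma norm_mul_gaussKernel_le {p : ℂ} {b s : ℝ} (hp : b ≤ p.re) (hs : 0 ≤ s) :
    ‖(s : ℂ) * gaussKernel p s‖ ≤ Real.exp (-(b - 1) * s - s ^ 2 / 4) := by
  rw [norm_mul, norm_gaussKernel, Complex.norm_real, Real.norm_of_nonneg hs]
  calc s * Real.exp (-p.re * s - s ^ 2 / 4)
      ≤ Real.exp s * Real.exp (-b * s - s ^ 2 / 4) := by
        gcongr
        linarith [Real.add_one_le_exp s]
    _ = Real.exp (-(b - 1) * s - s ^ 2 / 4) := by rw [← Real.exp_add]; congr 1; ring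

lemma integrableOn_mul_gaussKernel (p : ℂ) :
    IntegrableOn (fun s : ℝ => (s : ℂ) * gaussKernel p s) (Ioi 0) := by
  refine (integrable_exp_sub_sq (p.re - 1)).integrableOn.mono'
    ((continuous_ofReal.mul (continuous_gaussKernel p)).aestronglyMeasurable) ?_
  filter_upwards [ae_restrict_mem measurableSet_Ioi] with s hs
  exact norm_mul_gaussKernel_le le_rfl (le_of_lt hs)

/-- The two half-line integrals make up a full Gaussian integral. -/
theorem gaussLaplace_add_neg (p : ℂ) :
    gaussLaplace p + gaussLaplace (-p) = 2 * (√Real.pi : ℝ) * Complex.exp (p ^ 2) := by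
  have hneg : gaussLaplace (-p) = ∫ s in Iic (0 : ℝ), gaussKernel p s := by
    have h := integral_comp_neg_Ioi (0 : ℝ) (gaussKernel p)
    rw [neg_zero] at h
    rw [← h, gaussLaplace]
    congr 1 with s
    simp [gaussKernel]
  have hsplit := intervalIntegral.integral_Iic_add_Ioi (b := (0 : ℝ))
    (integrable_gaussKernel p).integrableOn (integrable_gaussKernel p).integrableOn
  rw [hneg, gaussLaplace, add_comm, hsplit]
  have h := integral_cexp_quadratic (b := -1 / 4) (by norm_num) (-p) 0
  have hk : ∀ s : ℝ, gaussKernel p s = Complex.exp (-1 / 4 * (s : ℂ) ^ 2 + -p * s + 0) := by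
    intro s
    rw [gaussKernel]; congr 1; ring
  simp_rw [hk, h]
  have h4 : ((Real.pi : ℂ) / -(-1 / 4)) ^ (1 / 2 : ℂ) = 2 * (√Real.pi : ℝ) := by
    have : ((Real.pi : ℂ) / -(-1 / 4)) = ((4 * Real.pi : ℝ) : ℂ) := by push_cast; ring
    rw [this, show (1 / 2 : ℂ) = ((1 / 2 : ℝ) : ℂ) by push_cast; ring,
      ← Complex.ofReal_cpow (by positivity), ← Real.sqrt_eq_rpow,
      Real.sqrt_mul (by norm_num), show (4 : ℝ) = 2 ^ 2 by norm_num, Real.sqrt_sq (by norm_num)]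
    push_cast; ring
  rw [h4]
  congr 2
  ring

lemma hasDerivAt_gaussKernel (p : ℂ) (s : ℝ) :
    HasDerivAt (gaussKernel p) ((-p - s / 2) * gaussKernel p s) s := by
  have h1 : HasDerivAt (fun z : ℂ => -p * z - z ^ 2 / 4) (-p - s / 2) (s : ℂ) := by
    have := ((hasDerivAt_id (s : ℂ)).const_mul (-p)).sub (((hasDerivAt_id (s : ℂ)).pow 2).div_const 4)
    refine this.congr_deriv ?_
    simp; ring
  have := (h1.cexp).comp_ofReal
  refine this.congr_deriv ?_
  rw [gaussKernel, mul_comm]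

lemma tendsto_gaussKernel (p : ℂ) : Tendsto (gaussKernel p) atTop (𝓝 0) := by
  rw [tendsto_zero_iff_norm_tendsto_zero]
  simp_rw [norm_gaussKernel]
  refine Real.tendsto_exp_atBot.comp ?_
  have : (fun s : ℝ => -p.re * s - s ^ 2 / 4) = fun s : ℝ => -(s * (p.re + s / 4)) := by
    ext s; ring
  rw [this]
  refine tendsto_neg_atTop_atBot.comp (tendsto_id.atTop_mul_atTop₀ ?_)
  exact tendsto_atTop_add_const_left _ _ (tendsto_id.atTop_div_const (by norm_num))

/-- Integration by parts. -/
theorem two_mul_mul_gaussLaplace (p : ℂ) :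
    2 * p * gaussLaplace p = 2 - ∫ s in Ioi (0 : ℝ), (s : ℂ) * gaussKernel p s := by
  have h1 : IntegrableOn (fun s : ℝ => -p * gaussKernel p s) (Ioi 0) :=
    (integrable_gaussKernel p).integrableOn.const_mul _
  have h2 : IntegrableOn (fun s : ℝ => 1 / 2 * ((s : ℂ) * gaussKernel p s)) (Ioi 0) :=
    (integrableOn_mul_gaussKernel p).const_mul _
  have heq : ∀ s : ℝ, (-p - s / 2) * gaussKernel p s =
      -p * gaussKernel p s - 1 / 2 * ((s : ℂ) * gaussKernel p s) := fun s => by ring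
  have h := integral_Ioi_of_hasDerivAt_of_tendsto' (a := (0 : ℝ)) (f := gaussKernel p)
    (fun s _ => hasDerivAt_gaussKernel p s)
    ((h1.sub h2).congr_fun (fun s _ => (heq s).symm) measurableSet_Ioi) (tendsto_gaussKernel p)
  simp_rw [heq] at h
  rw [integral_sub h1 h2, integral_const_mul, integral_const_mul] at h
  have h0 : gaussKernel p 0 = 1 := by simp [gaussKernel]
  rw [h0] at h
  rw [gaussLaplace]
  linear_combination (-2) * h

theorem hasDerivAt_gaussLaplace (p : ℂ) :
    HasDerivAt gaussLaplace (2 * p * gaussLaplace p - 2) p := by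
  have h := hasDerivAt_integral_of_dominated_loc_of_deriv_le (μ := volume.restrict (Ioi (0 : ℝ)))
    (F := gaussKernel) (F' := fun q s => -((s : ℂ) * gaussKernel q s)) (x₀ := p)
    (s := {q : ℂ | p.re - 1 < q.re})
    (bound := fun s => Real.exp (-(p.re - 1 - 1) * s - s ^ 2 / 4))
    ((isOpen_lt continuous_const Complex.continuous_re).mem_nhds (by simp))
    (Eventually.of_forall fun q => (continuous_gaussKernel q).aestronglyMeasurable)
    (integrable_gaussKernel p).integrableOn
    (continuous_ofReal.mul (continuous_gaussKernel p)).neg.aestronglyMeasurable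
    ?_ (integrable_exp_sub_sq _).integrableOn ?_
  · refine h.2.congr_deriv ?_
    rw [integral_neg, two_mul_mul_gaussLaplace]; ring
  · filter_upwards [ae_restrict_mem measurableSet_Ioi] with s hs q hq
    rw [norm_neg]
    exact norm_mul_gaussKernel_le (le_of_lt hq) (le_of_lt hs)
  · refine Eventually.of_forall fun s q _ => ?_
    have h1 : HasDerivAt (fun q : ℂ => -q * s - (s : ℂ) ^ 2 / 4) (-(s : ℂ)) q := by
      have := ((hasDerivAt_id q).neg.mul_const (s : ℂ)).sub_const ((s : ℂ) ^ 2 / 4)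
      exact this.congr_deriv (by simp)
    refine h1.cexp.congr_deriv ?_
    rw [gaussKernel]; ring

theorem norm_gaussLaplace_le_inv_re {p : ℂ} (hp : 0 < p.re) : ‖gaussLaplace p‖ ≤ 1 / p.re := by
  have h : ∫ s in Ioi (0 : ℝ), Real.exp (-p.re * s) = 1 / p.re := by
    rw [integral_exp_mul_Ioi (by linarith)]; simp [div_eq_mul_inv]
  rw [← h, gaussLaplace]
  refine norm_integral_le_of_norm_le (integrableOn_exp_mul_Ioi (by linarith) 0) ?_
  refine Eventually.of_forall fun s => ?_
  rw [norm_gaussKernel]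
  gcongr
  nlinarith [sq_nonneg s]

/-- The bound `|L(p)| ≤ 2/|p|` remains useful up to the imaginary axis. -/
theorem norm_gaussLaplace_le {p : ℂ} (hp : 0 ≤ p.re) (hp0 : p ≠ 0) :
    ‖gaussLaplace p‖ ≤ 2 / ‖p‖ := by
  have hI : IntegrableOn (fun s : ℝ => ‖(s : ℂ) * gaussKernel 0 s‖) (Ioi 0) :=
    (integrableOn_mul_gaussKernel 0).norm
  have hval : ∫ s in Ioi (0 : ℝ), ‖(s : ℂ) * gaussKernel 0 s‖ = 2 := by
    have h0 := two_mul_mul_gaussLaplace 0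
    have h1 : ∫ s in Ioi (0 : ℝ), (s : ℂ) * gaussKernel 0 s =
        ∫ s in Ioi (0 : ℝ), ((‖(s : ℂ) * gaussKernel 0 s‖ : ℝ) : ℂ) := by
      refine setIntegral_congr_fun measurableSet_Ioi fun s hs => ?_
      simp only [norm_mul, norm_gaussKernel, Complex.norm_real, Real.norm_of_nonneg (le_of_lt hs)]
      simp [gaussKernel]
    rw [h1, integral_complex_ofReal] at h0
    have h2 : ((∫ s in Ioi (0 : ℝ), ‖(s : ℂ) * gaussKernel 0 s‖ : ℝ) : ℂ) = ((2 : ℝ) : ℂ) := by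
      push_cast; linear_combination h0
    exact_mod_cast h2
  have hle : ‖∫ s in Ioi (0 : ℝ), (s : ℂ) * gaussKernel p s‖ ≤ 2 := by
    rw [← hval]
    refine norm_integral_le_of_norm_le hI ?_
    filter_upwards [ae_restrict_mem measurableSet_Ioi] with s hs
    rw [norm_mul, norm_mul, norm_gaussKernel, norm_gaussKernel, Complex.zero_re]
    have hs : (0 : ℝ) < s := hs
    gcongr
  have h4 : ‖2 * p * gaussLaplace p‖ ≤ 4 := by
    rw [two_mul_mul_gaussLaplace]
    refine (norm_sub_le _ _).trans ?_
    norm_num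
    linarith
  rw [norm_mul, norm_mul, Complex.norm_ofNat] at h4
  rw [le_div_iff₀ (norm_pos_iff.mpr hp0)]
  linarith

/-! ### The Fresnel integral in terms of the Gaussian Laplace transform -/

/-- The point `ρ(x) = x e^{-iπ/4}`, so that `F(x) = e^{-ρ²} L(ρ) / (2√π)`. -/
noncomputable def rho (x : ℝ) : ℂ := x * Complex.exp (-(Complex.I * Real.pi / 4))

lemma exp_neg_I_pi_div_four :
    Complex.exp (-(Complex.I * Real.pi / 4)) = ((1 / √2 : ℝ) : ℂ) - ((1 / √2 : ℝ) : ℂ) * I := by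
  have h : -(Complex.I * Real.pi / 4) = ((-(Real.pi / 4) : ℝ) : ℂ) * I := by push_cast; ring
  have h2 : √2 / 2 = 1 / √2 := by
    rw [div_eq_div_iff (by norm_num) (by positivity), Real.mul_self_sqrt (by norm_num)]; norm_num
  rw [h, Complex.exp_mul_I, ← Complex.ofReal_cos, ← Complex.ofReal_sin, Real.cos_neg, Real.sin_neg,
    Real.cos_pi_div_four, Real.sin_pi_div_four, h2]
  push_cast; ring

lemma rho_eq (x : ℝ) : rho x = ((x / √2 : ℝ) : ℂ) - ((x / √2 : ℝ) : ℂ) * I := by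
  rw [rho, exp_neg_I_pi_div_four]; push_cast; ring

lemma rho_re (x : ℝ) : (rho x).re = x / √2 := by
  rw [rho_eq, Complex.sub_re, Complex.ofReal_re, Complex.re_ofReal_mul, Complex.I_re]; ring

lemma rho_im (x : ℝ) : (rho x).im = -(x / √2) := by
  rw [rho_eq, Complex.sub_im, Complex.ofReal_im, Complex.im_ofReal_mul, Complex.I_im]; ring

lemma rho_sq (x : ℝ) : rho x ^ 2 = -(I * (x : ℂ) ^ 2) := by
  have h : Complex.exp (-(Complex.I * Real.pi / 4)) ^ 2 = -I := by
    rw [← Complex.exp_nat_mul]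
    have : ((2 : ℕ) : ℂ) * -(I * Real.pi / 4) = -(Real.pi / 2 * I) := by push_cast; ring
    rw [this, Complex.exp_neg, Complex.exp_pi_div_two_mul_I, Complex.inv_I]
  rw [rho, mul_pow, h]; ring

lemma rho_neg (x : ℝ) : rho (-x) = -rho x := by
  rw [rho, rho]; push_cast; ring

/-- The antiderivative `e^{-ρ(x)²} L(ρ(x))` of a multiple of the Fresnel integrand. -/
noncomputable def fresnelPrimitive (x : ℝ) : ℂ :=
  Complex.exp (I * (x : ℂ) ^ 2) * gaussLaplace (rho x)

lemma hasDerivAt_fresnelPrimitive (x : ℝ) :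
    HasDerivAt fresnelPrimitive
      (-2 * Complex.exp (-(I * Real.pi / 4)) * Complex.exp (I * (x : ℂ) ^ 2)) x := by
  set w : ℂ := Complex.exp (-(I * Real.pi / 4))
  have h1 : HasDerivAt (fun p : ℂ => Complex.exp (-p ^ 2) * gaussLaplace p)
      (-2 * Complex.exp (-(rho x) ^ 2)) (rho x) := by
    have hsq : HasDerivAt (fun p : ℂ => -p ^ 2) (-(2 * rho x)) (rho x) := by
      exact (hasDerivAt_pow 2 (rho x)).neg.congr_deriv (by simp)
    refine (hsq.cexp.mul (hasDerivAt_gaussLaplace (rho x))).congr_deriv ?_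
    ring
  have h2 : HasDerivAt (fun y : ℝ => rho y) w x := by
    have := (hasDerivAt_id (x : ℂ)).comp_ofReal.mul_const w
    simpa [rho] using this
  have h3 := HasDerivAt.comp x h1 h2
  have he : ∀ y : ℝ, Complex.exp (-(rho y) ^ 2) = Complex.exp (I * (y : ℂ) ^ 2) := by
    intro y; rw [rho_sq, neg_neg]
  have hf : fresnelPrimitive =
      (fun p : ℂ => Complex.exp (-p ^ 2) * gaussLaplace p) ∘ fun y : ℝ => rho y := by
    ext y; simp only [Function.comp, he, fresnelPrimitive]
  rw [hf]
  refine h3.congr_deriv ?_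
  rw [he]; ring

lemma norm_exp_I_mul_sq (x : ℝ) : ‖Complex.exp (I * (x : ℂ) ^ 2)‖ = 1 := by
  have : I * (x : ℂ) ^ 2 = ((x ^ 2 : ℝ) : ℂ) * I := by push_cast; ring
  rw [this, Complex.norm_exp_ofReal_mul_I]

lemma tendsto_fresnelPrimitive : Tendsto fresnelPrimitive atTop (𝓝 0) := by
  have hlim : Tendsto (fun x : ℝ => √2 / x) atTop (𝓝 0) :=
    tendsto_const_nhds.div_atTop tendsto_id
  refine squeeze_zero_norm' ?_ hlim
  filter_upwards [eventually_gt_atTop (0 : ℝ)] with x hx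
  have hre : 0 < (rho x).re := by rw [rho_re]; positivity
  have h := norm_gaussLaplace_le_inv_re hre
  rw [rho_re, one_div_div] at h
  rw [fresnelPrimitive, norm_mul, norm_exp_I_mul_sq, one_mul]
  exact h

theorem tendsto_fresnel_integral (x : ℝ) :
    Tendsto (fun R : ℝ => ∫ t in x..R, Complex.exp (I * (t : ℂ) ^ 2)) atTop
      (𝓝 (fresnelPrimitive x / (2 * Complex.exp (-(I * Real.pi / 4))))) := by
  set w : ℂ := Complex.exp (-(I * Real.pi / 4))
  have hw0 : w ≠ 0 := Complex.exp_ne_zero _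
  have key : ∀ R : ℝ, ∫ t in x..R, Complex.exp (I * (t : ℂ) ^ 2) =
      (fresnelPrimitive x - fresnelPrimitive R) / (2 * w) := by
    intro R
    have h := intervalIntegral.integral_eq_sub_of_hasDerivAt (a := x) (b := R)
      (fun t _ => hasDerivAt_fresnelPrimitive t) (Continuous.intervalIntegrable (by fun_prop) _ _)
    rw [intervalIntegral.integral_const_mul] at h
    rw [eq_div_iff (by simpa using hw0)]
    linear_combination -h
  simp_rw [key]
  simpa using (tendsto_fresnelPrimitive.const_sub (fresnelPrimitive x)).div_const (2 * w)

theorem F_eq (x : ℝ) :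
    F x = Complex.exp (I * (x : ℂ) ^ 2) / (2 * (√Real.pi : ℝ)) * gaussLaplace (rho x) := by
  have hw0 : Complex.exp (-(I * Real.pi / 4)) ≠ 0 := Complex.exp_ne_zero _
  have hpi : ((√Real.pi : ℝ) : ℂ) ≠ 0 := by
    rw [Complex.ofReal_ne_zero]; positivity
  rw [F, (tendsto_fresnel_integral x).limUnder_eq, fresnelPrimitive]
  field_simp

theorem F_neg (x : ℝ) : F (-x) = 1 - F x := by
  have hpi : ((√Real.pi : ℝ) : ℂ) ≠ 0 := by
    rw [Complex.ofReal_ne_zero]; positivity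
  have h := gaussLaplace_add_neg (rho x)
  rw [rho_sq] at h
  have h1 : Complex.exp (I * (x : ℂ) ^ 2) * Complex.exp (-(I * (x : ℂ) ^ 2)) = 1 := by
    rw [← Complex.exp_add, add_neg_cancel, Complex.exp_zero]
  rw [F_eq, F_eq, rho_neg]
  push_cast
  rw [neg_sq]
  field_simp
  linear_combination Complex.exp (I * (x : ℂ) ^ 2) * h + 2 * (√Real.pi : ℝ) * h1

theorem FN_neg (N : ℕ) (x : ℝ) : FN N (-x) = 1 - FN N x := by
  rw [FN, FN]
  have h : (A N * ((-x : ℝ) : ℂ) * Complex.exp (I * Real.pi / 4)) =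
      -(A N * x * Complex.exp (I * Real.pi / 4)) := by push_cast; ring
  rw [h, Complex.tan_neg]
  push_cast
  rw [neg_sq]
  ring

/-! ### The Fourier transform of the integrand -/

/-- The integrand `e^{-t²} / (x² + it²)` to which the midpoint rule is applied. -/
noncomputable def integrand (x t : ℝ) : ℂ :=
  Complex.exp (-(t : ℂ) ^ 2) / ((x : ℂ) ^ 2 + I * (t : ℂ) ^ 2)

lemma sq_add_I_mul_sq_ne_zero {x : ℝ} (hx : x ≠ 0) (t : ℝ) :
    (x : ℂ) ^ 2 + I * (t : ℂ) ^ 2 ≠ 0 := by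
  intro h
  have h1 := congrArg Complex.re h
  have h2 : (x : ℂ) ^ 2 + I * (t : ℂ) ^ 2 = ((x ^ 2 : ℝ) : ℂ) + ((t ^ 2 : ℝ) : ℂ) * I := by
    push_cast; ring
  rw [h2, Complex.add_re, Complex.ofReal_re, Complex.re_ofReal_mul, Complex.I_re] at h1
  simp at h1
  exact hx h1

lemma norm_sq_add_I_mul_sq (x t : ℝ) :
    ‖(x : ℂ) ^ 2 + I * (t : ℂ) ^ 2‖ = √(x ^ 4 + t ^ 4) := by
  have h2 : (x : ℂ) ^ 2 + I * (t : ℂ) ^ 2 = ((x ^ 2 : ℝ) : ℂ) + ((t ^ 2 : ℝ) : ℂ) * I := by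
    push_cast; ring
  rw [h2, Complex.norm_add_mul_I]
  congr 1; ring

lemma norm_exp_neg_sq (t : ℝ) : ‖Complex.exp (-(t : ℂ) ^ 2)‖ = Real.exp (-t ^ 2) := by
  rw [← Complex.ofReal_pow, ← Complex.ofReal_neg, ← Complex.ofReal_exp, Complex.norm_real,
    Real.norm_of_nonneg (Real.exp_pos _).le]

lemma norm_integrand (x t : ℝ) :
    ‖integrand x t‖ = Real.exp (-t ^ 2) / √(x ^ 4 + t ^ 4) := by
  rw [integrand, norm_div, norm_sq_add_I_mul_sq, norm_exp_neg_sq]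

lemma integrand_neg (x t : ℝ) : integrand x (-t) = integrand x t := by
  simp [integrand]

lemma continuous_integrand {x : ℝ} (hx : x ≠ 0) : Continuous (integrand x) := by
  unfold integrand
  exact Continuous.div (by fun_prop) (by fun_prop) (sq_add_I_mul_sq_ne_zero hx)

/-- The pole factor as a Laplace transform; the parameter `ρ(x)` lies in the right half-plane. -/
lemma integral_exp_neg_rho_mul_cos {x : ℝ} (hx : 0 < x) (t : ℝ) :
    ∫ s in Ioi (0 : ℝ), Complex.exp (-rho x * s) * Complex.cos (s * t) =
      I * rho x / ((x : ℂ) ^ 2 + I * (t : ℂ) ^ 2) := by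
  have hre : 0 < (rho x).re := by rw [rho_re]; positivity
  have hp : (-rho x + t * I).re < 0 := by simp [hre]
  have hm : (-rho x - t * I).re < 0 := by simp [hre]
  have heq : ∀ s : ℝ, Complex.exp (-rho x * s) * Complex.cos (s * t) =
      1 / 2 * Complex.exp ((-rho x + t * I) * s) + 1 / 2 * Complex.exp ((-rho x - t * I) * s) := by
    intro s
    have h1 : (-rho x + t * I) * s = -rho x * s + s * t * I := by ring
    have h2 : (-rho x - t * I) * s = -rho x * s + -(s * t) * I := by ring
    rw [Complex.cos, h1, h2, Complex.exp_add, Complex.exp_add]; ring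
  simp_rw [heq]
  rw [integral_add ((integrableOn_exp_mul_complex_Ioi hp 0).const_mul _)
    ((integrableOn_exp_mul_complex_Ioi hm 0).const_mul _), integral_const_mul, integral_const_mul,
    integral_exp_mul_complex_Ioi hp, integral_exp_mul_complex_Ioi hm]
  have hp0 : -rho x + t * I ≠ 0 := fun h => by rw [h] at hp; simp at hp
  have hm0 : -rho x - t * I ≠ 0 := fun h => by rw [h] at hm; simp at hm
  have hd := sq_add_I_mul_sq_ne_zero hx.ne' t
  have hprod : (-rho x + t * I) * (-rho x - t * I) = -I * ((x : ℂ) ^ 2 + I * (t : ℂ) ^ 2) := by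
    have := rho_sq x
    linear_combination this
  simp only [Complex.ofReal_zero, mul_zero, Complex.exp_zero]
  rw [eq_div_iff hd]
  field_simp
  linear_combination (-2 * I * rho x) * hprod + (2 * rho x) * ((x : ℂ) ^ 2 + I * (t : ℂ) ^ 2) * I_sq

lemma integral_exp_neg_sq_add (b : ℝ) :
    ∫ t : ℝ, Complex.exp (-(t : ℂ) ^ 2 + I * b * t) =
      (√Real.pi : ℝ) * Complex.exp (-(b : ℂ) ^ 2 / 4) := by
  have h := integral_cexp_quadratic (b := -1) (by norm_num) (I * b) 0
  have hk : ∀ t : ℝ, Complex.exp (-(t : ℂ) ^ 2 + I * b * t) =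
      Complex.exp (-1 * (t : ℂ) ^ 2 + I * b * t + 0) := by
    intro t; congr 1; ring
  simp_rw [hk, h]
  rw [neg_neg, div_one, show (1 / 2 : ℂ) = ((1 / 2 : ℝ) : ℂ) by push_cast; ring,
    ← Complex.ofReal_cpow (by positivity), ← Real.sqrt_eq_rpow]
  congr 2
  rw [mul_pow, I_sq]; ring

lemma integrable_exp_neg_sq_add (b : ℝ) :
    Integrable fun t : ℝ => Complex.exp (-(t : ℂ) ^ 2 + I * b * t) := by
  have h := integrable_cexp_quadratic' (b := -1) (by norm_num) (I * b) 0
  refine h.congr (Eventually.of_forall fun t => ?_)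
  simp only
  congr 1; ring

lemma integral_exp_neg_sq_mul_cos (c s : ℝ) :
    ∫ t : ℝ, Complex.exp (-(t : ℂ) ^ 2 + 2 * I * c * t) * Complex.cos (s * t) =
      (√Real.pi : ℝ) / 2 * (Complex.exp (-((c : ℂ) + s / 2) ^ 2) +
        Complex.exp (-((c : ℂ) - s / 2) ^ 2)) := by
  have heq : ∀ t : ℝ, Complex.exp (-(t : ℂ) ^ 2 + 2 * I * c * t) * Complex.cos (s * t) =
      1 / 2 * Complex.exp (-(t : ℂ) ^ 2 + I * (2 * c + s : ℝ) * t) +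
        1 / 2 * Complex.exp (-(t : ℂ) ^ 2 + I * (2 * c - s : ℝ) * t) := by
    intro t
    have h1 : -(t : ℂ) ^ 2 + I * (2 * c + s : ℝ) * t =
      (-(t : ℂ) ^ 2 + 2 * I * c * t) + s * t * I := by push_cast; ring
    have h2 : -(t : ℂ) ^ 2 + I * (2 * c - s : ℝ) * t =
      (-(t : ℂ) ^ 2 + 2 * I * c * t) + -(s * t) * I := by push_cast; ring
    rw [Complex.cos, h1, h2, Complex.exp_add _ (s * t * I), Complex.exp_add _ (-(s * t) * I)]; ring
  simp_rw [heq]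
  rw [integral_add ((integrable_exp_neg_sq_add _).const_mul _)
    ((integrable_exp_neg_sq_add _).const_mul _), integral_const_mul, integral_const_mul,
    integral_exp_neg_sq_add, integral_exp_neg_sq_add]
  have h1 : -((2 * c + s : ℝ) : ℂ) ^ 2 / 4 = -((c : ℂ) + s / 2) ^ 2 := by push_cast; ring
  have h2 : -((2 * c - s : ℝ) : ℂ) ^ 2 / 4 = -((c : ℂ) - s / 2) ^ 2 := by push_cast; ring
  rw [h1, h2]; ring

/-- The Fourier transform of the integrand, by writing the pole factor as a Laplace transform and
exchanging the integrals. -/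
theorem integral_integrand_mul_exp {x : ℝ} (hx : 0 < x) (c : ℝ) :
    ∫ t : ℝ, integrand x t * Complex.exp (2 * I * c * t) =
      (√Real.pi : ℝ) / (2 * I * rho x) * (Complex.exp (-(c : ℂ) ^ 2) *
        (gaussLaplace (rho x - c) + gaussLaplace (rho x + c))) := by
  have hre : 0 < (rho x).re := by rw [rho_re]; positivity
  have hrho : rho x ≠ 0 := fun h => by rw [h] at hre; simp at hre
  let G : ℝ → ℝ → ℂ := fun t s =>
    Complex.exp (-(t : ℂ) ^ 2 + 2 * I * c * t) * (Complex.exp (-rho x * s) * Complex.cos (s * t))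
  have hGint : Integrable (Function.uncurry G) (volume.prod (volume.restrict (Ioi (0 : ℝ)))) := by
    have hb := (integrable_exp_neg_sq_add (2 * c)).norm.mul_prod
      (integrableOn_exp_mul_complex_Ioi (a := -rho x) (by simpa using hre) 0).norm
    refine hb.mono' ?_ ?_
    · refine Continuous.aestronglyMeasurable ?_
      simp only [G, Function.uncurry_def]
      fun_prop
    · refine Eventually.of_forall fun z => ?_
      obtain ⟨t, s⟩ := z
      simp only [Function.uncurry_apply_pair, G, norm_mul]
      have h1 : -(t : ℂ) ^ 2 + 2 * I * c * t = -(t : ℂ) ^ 2 + I * (2 * c : ℝ) * t := by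
        push_cast; ring
      have h2 : ‖Complex.cos (s * t)‖ ≤ 1 := by
        rw [← Complex.ofReal_mul, ← Complex.ofReal_cos, Complex.norm_real]
        exact Real.abs_cos_le_one _
      rw [h1]
      gcongr
      exact mul_le_of_le_one_right (norm_nonneg _) h2
  have hswap := integral_integral_swap hGint
  have hleft : ∀ t : ℝ, ∫ s in Ioi (0 : ℝ), G t s =
      I * rho x * (integrand x t * Complex.exp (2 * I * c * t)) := by
    intro t
    simp only [G]
    rw [integral_const_mul, integral_exp_neg_rho_mul_cos hx, Complex.exp_add, integrand]
    ring
  have hright : ∀ s : ℝ, ∫ t : ℝ, G t s = (√Real.pi : ℝ) / 2 * Complex.exp (-(c : ℂ) ^ 2) *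
      (gaussKernel (rho x + c) s + gaussKernel (rho x - c) s) := by
    intro s
    have h : ∀ t : ℝ, G t s = Complex.exp (-rho x * s) *
        (Complex.exp (-(t : ℂ) ^ 2 + 2 * I * c * t) * Complex.cos (s * t)) := fun t => by
      simp only [G]; ring
    simp_rw [h]
    rw [integral_const_mul, integral_exp_neg_sq_mul_cos]
    have h1 : Complex.exp (-rho x * s) * Complex.exp (-((c : ℂ) + s / 2) ^ 2) =
        Complex.exp (-(c : ℂ) ^ 2) * gaussKernel (rho x + c) s := by
      rw [gaussKernel, ← Complex.exp_add, ← Complex.exp_add]; congr 1; ring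
    have h2 : Complex.exp (-rho x * s) * Complex.exp (-((c : ℂ) - s / 2) ^ 2) =
        Complex.exp (-(c : ℂ) ^ 2) * gaussKernel (rho x - c) s := by
      rw [gaussKernel, ← Complex.exp_add, ← Complex.exp_add]; congr 1; ring
    linear_combination (√Real.pi : ℝ) / 2 * h1 + (√Real.pi : ℝ) / 2 * h2
  simp_rw [hleft, hright] at hswap
  rw [integral_const_mul, integral_const_mul, integral_add (integrable_gaussKernel _).integrableOn
    (integrable_gaussKernel _).integrableOn, ← gaussLaplace, ← gaussLaplace] at hswap
  have hI := I_ne_zero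
  have h2 : (√Real.pi : ℝ) / (2 * I * rho x) * (Complex.exp (-(c : ℂ) ^ 2) *
        (gaussLaplace (rho x - c) + gaussLaplace (rho x + c))) =
      ((√Real.pi : ℝ) / 2 * Complex.exp (-(c : ℂ) ^ 2) *
        (gaussLaplace (rho x + c) + gaussLaplace (rho x - c))) / (I * rho x) := by
    field_simp
    ring
  rw [h2, ← hswap]
  field_simp

/-! ### Poisson summation for the midpoint rule -/

/-- The Fourier transform of `integrand x` at frequency `c / π`, up to the constant
`√π / (2iρ)`. -/
noncomputable def fourierTerm (x c : ℝ) : ℂ :=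
  Complex.exp (-(c : ℂ) ^ 2) * (gaussLaplace (rho x - c) + gaussLaplace (rho x + c))

lemma fourierTerm_neg (x c : ℝ) : fourierTerm x (-c) = fourierTerm x c := by
  simp only [fourierTerm]
  push_cast
  rw [neg_sq, sub_neg_eq_add, ← sub_eq_add_neg, add_comm]

lemma fourierTerm_zero (x : ℝ) : fourierTerm x 0 = 2 * gaussLaplace (rho x) := by
  simp [fourierTerm]; ring

/-- Completing the square in `e^{-(c - s/2)²}` at an arbitrary frequency `δ < Re ρ`; this is what
shifting the line of integration up to height `δ` would give. -/
lemma norm_exp_mul_gaussLaplace_sub_le {p : ℂ} {δ : ℝ} (hδ : δ < p.re) (c : ℝ) :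
    ‖Complex.exp (-(c : ℂ) ^ 2) * gaussLaplace (p - c)‖ ≤
      Real.exp (δ ^ 2 - 2 * δ * c) * (1 / (p.re - δ)) := by
  have h : ∫ s in Ioi (0 : ℝ), Real.exp (-(p.re - δ) * s) = 1 / (p.re - δ) := by
    rw [integral_exp_mul_Ioi (by linarith)]; simp [-neg_sub, div_eq_mul_inv]
  rw [norm_mul, norm_exp_neg_sq, ← h, gaussLaplace, ← integral_const_mul,
    ← Real.norm_of_nonneg (Real.exp_pos (-c ^ 2)).le, ← norm_smul, ← integral_smul]
  refine norm_integral_le_of_norm_le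
    ((integrableOn_exp_mul_Ioi (by linarith) 0).const_mul _) ?_
  refine Eventually.of_forall fun s => ?_
  rw [norm_smul, norm_gaussKernel, Real.norm_of_nonneg (Real.exp_pos _).le, ← Real.exp_add,
    ← Real.exp_add, Complex.sub_re, Complex.ofReal_re]
  apply Real.exp_le_exp.mpr
  nlinarith [sq_nonneg (c - s / 2 - δ)]

lemma exp_neg_sq_le (c δ : ℝ) : Real.exp (-c ^ 2) ≤ Real.exp (δ ^ 2 - 2 * δ * c) := by
  gcongr
  nlinarith [sq_nonneg (c - δ)]

lemma norm_exp_mul_gaussLaplace_add_le {p : ℂ} (hp : 0 < p.re) {δ c : ℝ} (hδ : 0 ≤ δ)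
    (hc : δ ≤ c) :
    ‖Complex.exp (-(c : ℂ) ^ 2) * gaussLaplace (p + c)‖ ≤
      Real.exp (δ ^ 2 - 2 * δ * c) * (1 / (p.re + δ)) := by
  rw [norm_mul, norm_exp_neg_sq]
  have hre : (p + c).re = p.re + c := by simp
  have h := norm_gaussLaplace_le_inv_re (p := p + c) (by rw [hre]; linarith)
  rw [hre] at h
  have h2 : 1 / (p.re + c) ≤ 1 / (p.re + δ) := by
    apply one_div_le_one_div_of_le <;> linarith
  exact mul_le_mul (exp_neg_sq_le c δ) (h.trans h2) (norm_nonneg _) (Real.exp_pos _).le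

lemma norm_fourierTerm_le {x δ c : ℝ} (hδ : 0 ≤ δ) (hx : δ < x / √2) (hc : δ ≤ c) :
    ‖fourierTerm x c‖ ≤
      Real.exp (δ ^ 2 - 2 * δ * c) * (1 / (x / √2 - δ) + 1 / (x / √2 + δ)) := by
  have h1 := norm_exp_mul_gaussLaplace_sub_le (p := rho x) (δ := δ) (by rw [rho_re]; exact hx) c
  have h2 := norm_exp_mul_gaussLaplace_add_le (p := rho x) (by rw [rho_re]; linarith) hδ hc
  rw [rho_re] at h1 h2
  rw [fourierTerm, mul_add, mul_add]
  exact (norm_add_le _ _).trans (add_le_add h1 h2)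

lemma hasSum_exp_sub {δ α : ℝ} (h : 0 < δ * α) :
    HasSum (fun n : ℕ => Real.exp (δ ^ 2 - 2 * δ * ((n + 1) * α)))
      (Real.exp (δ ^ 2 - 2 * δ * α) / (1 - Real.exp (-2 * (δ * α)))) := by
  have hg := (hasSum_geometric_of_lt_one (r := Real.exp (-2 * (δ * α))) (Real.exp_pos _).le
    (by rw [Real.exp_lt_one_iff]; linarith)).mul_left (Real.exp (δ ^ 2 - 2 * δ * α))
  rw [← div_eq_mul_inv] at hg
  refine hg.congr_fun fun n => ?_
  rw [← Real.exp_nat_mul, ← Real.exp_add]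
  congr 1; ring

lemma summable_norm_fourierTerm {x α : ℝ} (hx : 0 < x) (hα : 0 < α) :
    Summable fun n : ℕ => ‖fourierTerm x ((n + 1) * α)‖ := by
  have ha : 0 < x / √2 := by positivity
  set δ := min (x / √2 / 2) α
  have hδ0 : 0 < δ := lt_min (by positivity) hα
  have hδx : δ < x / √2 := (min_le_left _ _).trans_lt (by linarith)
  refine Summable.of_nonneg_of_le (fun _ => norm_nonneg _) (fun n => ?_)
    ((hasSum_exp_sub (mul_pos hδ0 hα)).summable.mul_right
      (1 / (x / √2 - δ) + 1 / (x / √2 + δ)))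
  refine norm_fourierTerm_le hδ0.le hδx ((min_le_right _ _).trans ?_)
  nlinarith [(Nat.cast_nonneg n : (0 : ℝ) ≤ n)]

lemma summable_integrand {x h : ℝ} (hx : 0 < x) (hh : 0 < h) :
    Summable fun n : ℕ => integrand x ((n + 1 / 2) * h) := by
  have hg := (summable_geometric_of_lt_one (r := Real.exp (-h ^ 2)) (Real.exp_pos _).le
    (by rw [Real.exp_lt_one_iff]; have := pow_pos hh 2; linarith)).mul_right (1 / x ^ 2)
  refine Summable.of_norm_bounded hg fun n => ?_
  rw [norm_integrand, ← Real.exp_nat_mul, mul_one_div]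
  have h2 : x ^ 2 ≤ √(x ^ 4 + ((n + 1 / 2) * h) ^ 4) := by
    apply Real.le_sqrt_of_sq_le
    nlinarith [sq_nonneg (((n + 1 / 2) * h) ^ 2)]
  gcongr
  nlinarith [mul_nonneg (sq_nonneg (n : ℝ)) (sq_nonneg h), sq_nonneg h]

lemma integrand_isBigO {x h : ℝ} (hx : 0 < x) (hh : 0 < h) :
    (fun y : ℝ => integrand x (h * y)) =O[cocompact ℝ] fun y : ℝ => |y| ^ (-(2 : ℝ)) := by
  refine Asymptotics.IsBigO.of_bound (1 / h ^ 2) ?_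
  filter_upwards [(isCompact_singleton (x := (0 : ℝ))).compl_mem_cocompact] with y hy
  have hy : 0 < |y| := abs_pos.mpr hy
  rw [norm_integrand, Real.norm_of_nonneg (by positivity), Real.rpow_neg hy.le]
  have h2 : (h * |y|) ^ 2 ≤ √(x ^ 4 + (h * y) ^ 4) := by
    apply Real.le_sqrt_of_sq_le
    have : ((h * |y|) ^ 2) ^ 2 = (h * y) ^ 4 := by
      rw [mul_pow, sq_abs]; ring
    rw [this]; nlinarith [pow_pos hx 4]
  have h3 : Real.exp (-(h * y) ^ 2) ≤ 1 := by
    rw [Real.exp_le_one_iff]; nlinarith [sq_nonneg (h * y)]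
  calc Real.exp (-(h * y) ^ 2) / √(x ^ 4 + (h * y) ^ 4) ≤ 1 / (h * |y|) ^ 2 := by gcongr
    _ = 1 / h ^ 2 * (|y| ^ (2 : ℝ))⁻¹ := by
      rw [show (2 : ℝ) = ((2 : ℕ) : ℝ) by norm_num, Real.rpow_natCast]; field_simp

lemma fourier_integrand {x α : ℝ} (hx : 0 < x) (hα : 0 < α) (w : ℝ) :
    FourierTransform.fourier (fun y : ℝ => integrand x (Real.pi / α * y)) w =
      (α / Real.pi : ℝ) * ((√Real.pi : ℝ) / (2 * I * rho x)) * fourierTerm x (w * α) := by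
  have hpi := Real.pi_pos
  rw [Real.fourier_real_eq_integral_exp_smul]
  have h1 : ∀ v : ℝ, Complex.exp (↑(-2 * Real.pi * v * w) * I) • integrand x (Real.pi / α * v) =
      (fun t : ℝ => integrand x t * Complex.exp (2 * I * ((-(w * α) : ℝ) : ℂ) * t))
        (Real.pi / α * v) := by
    intro v
    simp only [smul_eq_mul]
    rw [mul_comm]
    congr 2
    have : (α : ℂ) ≠ 0 := by exact_mod_cast hα.ne'
    push_cast
    field_simp
  simp_rw [h1]
  rw [Measure.integral_comp_mul_left
    (fun t : ℝ => integrand x t * Complex.exp (2 * I * ((-(w * α) : ℝ) : ℂ) * t)),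
    integral_integrand_mul_exp hx, ← fourierTerm, fourierTerm_neg, inv_div,
    abs_of_pos (by positivity), Complex.real_smul]
  ring

/-- The midpoint rule with step `π / α` equals the integral plus its aliasing terms. -/
theorem tsum_integrand {x α : ℝ} (hx : 0 < x) (hα : 0 < α) :
    2 * ∑' n : ℕ, integrand x ((n + 1 / 2) * (Real.pi / α)) =
      (α / Real.pi : ℝ) * ((√Real.pi : ℝ) / (2 * I * rho x)) * (2 * gaussLaplace (rho x) +
        2 * ∑' n : ℕ, (-1) ^ (n + 1) * fourierTerm x ((n + 1) * α)) := by
  set κ : ℂ := (α / Real.pi : ℝ) * ((√Real.pi : ℝ) / (2 * I * rho x))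
  set h := Real.pi / α
  have hh0 : 0 < h := div_pos Real.pi_pos hα
  set g : ℝ → ℂ := fun y => integrand x (h * y) with hg
  have hs := summable_integrand hx hh0
  have hF : ∀ w : ℝ, FourierTransform.fourier g w = κ * fourierTerm x (w * α) :=
    fourier_integrand hx hα
  have hT := (summable_norm_fourierTerm hx hα).of_norm
  have hFsum : Summable fun n : ℤ => FourierTransform.fourier g n := by
    refine Summable.of_add_one_of_neg_add_one ?_ ?_
    · refine (hT.mul_left κ).congr fun n => ?_
      rw [hF]; push_cast; rfl
    · refine (hT.mul_left κ).congr fun n => ?_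
      rw [hF]; push_cast; rw [neg_mul, fourierTerm_neg]
  have hP := Real.tsum_eq_tsum_fourier_of_rpow_decay_of_summable (f := g) (b := 2)
    ((continuous_integrand hx.ne').comp (by fun_prop)) (by norm_num)
    (integrand_isBigO hx hh0) hFsum (1 / 2)
  have hsign : ∀ n : ℤ, fourier n ((1 / 2 : ℝ) : UnitAddCircle) = (-1 : ℂ) ^ n := by
    intro n
    rw [fourier_coe_apply, ← Complex.exp_pi_mul_I, ← Complex.exp_int_mul]
    congr 1; push_cast; ring
  have hL : ∑' n : ℤ, g (1 / 2 + n) = 2 * ∑' n : ℕ, integrand x ((n + 1 / 2) * h) := by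
    have e1 : ∀ n : ℕ, g (1 / 2 + ((n : ℤ) : ℝ)) = integrand x ((n + 1 / 2) * h) := by
      intro n; simp only [hg]; congr 1; push_cast; ring
    have e2 : ∀ n : ℕ, g (1 / 2 + ((-((n : ℤ) + 1) : ℤ) : ℝ)) =
        integrand x ((n + 1 / 2) * h) := by
      intro n; simp only [hg]; rw [← integrand_neg]; congr 1; push_cast; ring
    rw [tsum_of_nat_of_neg_add_one (f := fun n : ℤ => g (1 / 2 + n))
      (hs.congr fun n => (e1 n).symm) (hs.congr fun n => (e2 n).symm)]
    simp_rw [e1, e2]; ring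
  have hsg : Summable fun n : ℕ => (-1 : ℂ) ^ (n + 1) * fourierTerm x ((n + 1) * α) := by
    refine Summable.of_norm ((summable_norm_fourierTerm hx hα).congr fun n => ?_)
    simp
  have hR : ∑' n : ℤ, FourierTransform.fourier g n * fourier n ((1 / 2 : ℝ) : UnitAddCircle) =
      κ * (2 * gaussLaplace (rho x) +
        2 * ∑' n : ℕ, (-1) ^ (n + 1) * fourierTerm x ((n + 1) * α)) := by
    have e1 : ∀ n : ℕ, FourierTransform.fourier g (((n : ℤ) + 1 : ℤ) : ℝ) *
        fourier ((n : ℤ) + 1) ((1 / 2 : ℝ) : UnitAddCircle) =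
        κ * ((-1) ^ (n + 1) * fourierTerm x ((n + 1) * α)) := by
      intro n
      rw [hF, hsign]
      push_cast
      have : (-1 : ℂ) ^ ((n : ℤ) + 1) = (-1) ^ (n + 1) := by
        rw [← zpow_natCast]; push_cast; rfl
      rw [this]; ring
    have e2 : ∀ n : ℕ, FourierTransform.fourier g ((-((n : ℤ) + 1) : ℤ) : ℝ) *
        fourier (-((n : ℤ) + 1)) ((1 / 2 : ℝ) : UnitAddCircle) =
        κ * ((-1) ^ (n + 1) * fourierTerm x ((n + 1) * α)) := by
      intro n
      rw [hF, hsign]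
      push_cast
      have : (-1 : ℂ) ^ (-((n : ℤ) + 1)) = (-1) ^ (n + 1) := by
        rw [zpow_neg, ← inv_zpow, inv_neg, inv_one, ← zpow_natCast]; push_cast; rfl
      rw [this, neg_mul, fourierTerm_neg]; ring
    rw [tsum_of_add_one_of_neg_add_one
      (f := fun n : ℤ => FourierTransform.fourier g n * fourier n ((1 / 2 : ℝ) : UnitAddCircle))
      ((hsg.mul_left κ).congr fun n => (e1 n).symm) ((hsg.mul_left κ).congr fun n => (e2 n).symm)]
    simp_rw [e1, e2]
    rw [tsum_mul_left, hF, hsign]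
    rw [Int.cast_zero, zero_mul, fourierTerm_zero, zpow_zero]
    ring
  rw [← hL, hP, hR]

/-! ### The error as an alternating series -/

lemma A_pos (N : ℕ) : 0 < A N := Real.sqrt_pos.mpr (by positivity)

lemma A_sq (N : ℕ) : A N ^ 2 = ((N : ℝ) + 1 / 2) * Real.pi := Real.sq_sqrt (by positivity)

lemma node_eq (N k : ℕ) : node N k = ((k : ℝ) - 1 / 2) * (Real.pi / A N) := by
  rw [node, A, mul_div_assoc]

lemma mul_exp_I_pi_div_four (x : ℝ) : (x : ℂ) * Complex.exp (I * Real.pi / 4) = I * rho x := by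
  have h : Complex.exp (I * Real.pi / 4) = I * Complex.exp (-(I * Real.pi / 4)) := by
    nth_rewrite 2 [← Complex.exp_pi_div_two_mul_I]
    rw [← Complex.exp_add]
    congr 1; ring
  rw [rho, h]; ring

/-- The modulus of `e^{-2cρ(x)}`, the geometric ratio of the residues at the pole. -/
lemma norm_exp_neg_two_mul_rho (x c : ℝ) :
    ‖Complex.exp (-2 * c * rho x)‖ = Real.exp (-(√2 * c * x)) := by
  have h : (-2 * (c : ℂ) * rho x).re = -2 * c * (rho x).re := by
    rw [show (-2 * (c : ℂ) * rho x) = ((-2 * c : ℝ) : ℂ) * rho x by push_cast; ring,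
      Complex.re_ofReal_mul]
  rw [Complex.norm_exp, h, rho_re]
  congr 1
  have h2 : √2 * √2 = 2 := Real.mul_self_sqrt (by norm_num)
  field_simp
  linear_combination (c * x) * h2

lemma norm_exp_neg_two_mul_rho_lt_one {x α : ℝ} (hx : 0 < x) (hα : 0 < α) :
    ‖Complex.exp (-2 * α * rho x)‖ < 1 := by
  rw [norm_exp_neg_two_mul_rho, Real.exp_lt_one_iff, neg_lt_zero]; positivity

lemma one_add_exp_ne_zero {x α : ℝ} (hx : 0 < x) (hα : 0 < α) :
    1 + Complex.exp (-2 * α * rho x) ≠ 0 := by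
  intro h
  have h1 := norm_exp_neg_two_mul_rho_lt_one hx hα
  rw [eq_neg_of_add_eq_zero_right h, norm_neg, norm_one] at h1
  exact lt_irrefl _ h1

/-- The tangent term of `FN` sums the geometric series of the residues at the pole. -/
lemma half_add_tan {x α : ℝ} (hx : 0 < x) (hα : 0 < α) :
    1 / 2 + I / 2 * Complex.tan (α * x * Complex.exp (I * Real.pi / 4)) =
      Complex.exp (-2 * α * rho x) / (1 + Complex.exp (-2 * α * rho x)) := by
  have hq := one_add_exp_ne_zero hx hα
  have h1 : Complex.exp (-2 * α * rho x) =
      Complex.exp (-α * rho x) * Complex.exp (-α * rho x) := by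
    rw [← Complex.exp_add]; congr 1; ring
  have h2 : Complex.exp (α * rho x) * Complex.exp (-α * rho x) = 1 := by
    rw [← Complex.exp_add, neg_mul, add_neg_cancel, Complex.exp_zero]
  have hw : α * x * Complex.exp (I * Real.pi / 4) = α * rho x * I := by
    rw [mul_assoc, mul_exp_I_pi_div_four]; ring
  rw [h1] at hq ⊢
  rw [hw, Complex.tan_mul_I, Complex.tanh_eq_sinh_div_cosh, Complex.sinh, Complex.cosh, ← neg_mul]
  set e := Complex.exp (-α * rho x)
  set f := Complex.exp (α * rho x)
  have hfe : f + e ≠ 0 := by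
    intro h
    apply hq
    linear_combination e * h - h2
  have h3 : 1 / 2 + I / 2 * ((f - e) / 2 / ((f + e) / 2) * I) = e / (f + e) := by
    field_simp
    rw [I_sq]
    ring
  rw [h3, div_eq_div_iff hfe hq]
  linear_combination -e * h2

/-- The remainder of the midpoint sum beyond the nodes used by `FN`. -/
noncomputable def tail (N : ℕ) (x : ℝ) : ℂ :=
  ∑' n : ℕ, integrand x (A N + n * (Real.pi / A N))

lemma half_mul_pi_div_A (N : ℕ) : ((N : ℝ) + 1 / 2) * (Real.pi / A N) = A N := by
  rw [← mul_div_assoc, ← A_sq, sq, mul_div_assoc, div_self (A_pos N).ne', mul_one]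

lemma sum_add_tail (N : ℕ) {x : ℝ} (hx : 0 < x) :
    ∑ k ∈ Finset.Icc 1 N, Complex.exp (-(node N k : ℂ) ^ 2) /
        ((x : ℂ) ^ 2 + Complex.I * (node N k : ℂ) ^ 2) + tail N x =
      ∑' n : ℕ, integrand x ((n + 1 / 2) * (Real.pi / A N)) := by
  have hs := summable_integrand hx (div_pos Real.pi_pos (A_pos N))
  rw [← hs.sum_add_tsum_nat_add N]
  congr 1
  · rw [← Finset.Ico_add_one_right_eq_Icc, Finset.sum_Ico_eq_sum_range]
    refine Finset.sum_congr (by simp) fun n _ => ?_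
    have : node N (1 + n) = (n + 1 / 2) * (Real.pi / A N) := by
      rw [node_eq]; push_cast; ring
    rw [this, integrand]
  · rw [tail]
    refine tsum_congr fun n => ?_
    congr 1
    push_cast
    linear_combination -half_mul_pi_div_A N

/-- The error in terms of the aliasing terms, with the pole contribution of `FN` kept apart. -/
theorem F_sub_FN_eq (N : ℕ) {x : ℝ} (hx : 0 < x) :
    F x - FN N x = I * rho x * Complex.exp (I * (x : ℂ) ^ 2) / A N * tail N x -
      Complex.exp (-2 * A N * rho x) / (1 + Complex.exp (-2 * A N * rho x)) -
      Complex.exp (I * (x : ℂ) ^ 2) / (2 * (√Real.pi : ℝ)) *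
        ∑' n : ℕ, (-1) ^ (n + 1) * fourierTerm x ((n + 1) * A N) := by
  have hA : (A N : ℂ) ≠ 0 := by exact_mod_cast (A_pos N).ne'
  have hpi : (Real.pi : ℂ) ≠ 0 := by exact_mod_cast Real.pi_ne_zero
  have hspi : ((√Real.pi : ℝ) : ℂ) ≠ 0 := by
    rw [Complex.ofReal_ne_zero]; positivity
  have hspi2 : ((√Real.pi : ℝ) : ℂ) ^ 2 = Real.pi := by
    rw [← Complex.ofReal_pow, Real.sq_sqrt Real.pi_pos.le]
  have hrho : rho x ≠ 0 := by
    rw [rho]; exact mul_ne_zero (by exact_mod_cast hx.ne') (Complex.exp_ne_zero _)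
  have h1 := tsum_integrand hx (A_pos N)
  have h2 := sum_add_tail N hx
  have he : Complex.exp (I * ((x : ℂ) ^ 2 + Real.pi / 4)) =
      Complex.exp (I * (x : ℂ) ^ 2) * Complex.exp (I * Real.pi / 4) := by
    rw [← Complex.exp_add]; congr 1; ring
  have hk : (x : ℂ) / A N * Complex.exp (I * ((x : ℂ) ^ 2 + Real.pi / 4)) =
      I * rho x * Complex.exp (I * (x : ℂ) ^ 2) / A N := by
    rw [he, ← mul_exp_I_pi_div_four]; ring
  rw [FN, F_eq, half_add_tan hx (A_pos N), hk, eq_sub_of_add_eq h2]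
  set S := ∑' n : ℕ, integrand x ((n + 1 / 2) * (Real.pi / A N))
  set T := ∑' n : ℕ, (-1) ^ (n + 1) * fourierTerm x ((n + 1) * A N)
  have h3 : S = (A N / Real.pi) * ((√Real.pi : ℝ) / (2 * I * rho x)) *
      (gaussLaplace (rho x) + T) := by
    push_cast at h1
    linear_combination h1 / 2
  have h4 : I * rho x * Complex.exp (I * (x : ℂ) ^ 2) / A N * S =
      Complex.exp (I * (x : ℂ) ^ 2) / (2 * (√Real.pi : ℝ)) * (gaussLaplace (rho x) + T) := by
    rw [h3]
    have hI := I_ne_zero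
    field_simp
    rw [hspi2]
  linear_combination -h4

/-- The complement of `fourierTerm` to a pure exponential: what remains of the aliasing term once
the contribution of the pole is removed. -/
noncomputable def poleFreeTerm (x c : ℝ) : ℂ :=
  Complex.exp (-(c : ℂ) ^ 2) * (gaussLaplace (c - rho x) - gaussLaplace (c + rho x))

lemma fourierTerm_add_poleFreeTerm (x c : ℝ) :
    fourierTerm x c + poleFreeTerm x c =
      2 * (√Real.pi : ℝ) * (Complex.exp (-(I * (x : ℂ) ^ 2)) * Complex.exp (-2 * c * rho x)) := by
  have h := gaussLaplace_add_neg ((c : ℂ) - rho x)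
  have he : Complex.exp (-(c : ℂ) ^ 2) * Complex.exp (((c : ℂ) - rho x) ^ 2) =
      Complex.exp (-(I * (x : ℂ) ^ 2)) * Complex.exp (-2 * c * rho x) := by
    rw [← Complex.exp_add, ← Complex.exp_add, ← rho_sq]; congr 1; ring
  rw [neg_sub] at h
  rw [fourierTerm, poleFreeTerm, ← he, add_comm (rho x) (c : ℂ)]
  linear_combination Complex.exp (-(c : ℂ) ^ 2) * h

/-- The error in terms of the pole-free aliasing terms. -/
theorem F_sub_FN_eq_poleFree (N : ℕ) {x : ℝ} (hx : 0 < x) :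
    F x - FN N x = I * rho x * Complex.exp (I * (x : ℂ) ^ 2) / A N * tail N x +
      Complex.exp (I * (x : ℂ) ^ 2) / (2 * (√Real.pi : ℝ)) *
        ∑' n : ℕ, (-1) ^ (n + 1) * poleFreeTerm x ((n + 1) * A N) := by
  have hspi : ((√Real.pi : ℝ) : ℂ) ≠ 0 := by
    rw [Complex.ofReal_ne_zero]; positivity
  set q := Complex.exp (-2 * A N * rho x) with hq
  have hq1 : ‖q‖ < 1 := norm_exp_neg_two_mul_rho_lt_one hx (A_pos N)
  have hq0 : 1 + q ≠ 0 := one_add_exp_ne_zero hx (A_pos N)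
  have hT : Summable fun n : ℕ => (-1 : ℂ) ^ (n + 1) * fourierTerm x ((n + 1) * A N) := by
    refine Summable.of_norm ((summable_norm_fourierTerm hx (A_pos N)).congr fun n => ?_)
    simp
  have hgeo := (hasSum_geometric_of_norm_lt_one (ξ := -q) (by rwa [norm_neg])).mul_left
    (2 * (√Real.pi : ℝ) * Complex.exp (-(I * (x : ℂ) ^ 2)) * -q)
  have hterm : ∀ n : ℕ, (-1 : ℂ) ^ (n + 1) * poleFreeTerm x ((n + 1) * A N) =
      2 * (√Real.pi : ℝ) * Complex.exp (-(I * (x : ℂ) ^ 2)) * -q * (-q) ^ n -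
        (-1) ^ (n + 1) * fourierTerm x ((n + 1) * A N) := by
    intro n
    have h := fourierTerm_add_poleFreeTerm x ((n + 1) * A N)
    have hqn : Complex.exp (-2 * (((n + 1) * A N : ℝ) : ℂ) * rho x) = q ^ (n + 1) := by
      rw [hq, ← Complex.exp_nat_mul]; congr 1; push_cast; ring
    rw [hqn] at h
    have hsq : ((-1 : ℂ) ^ (n + 1)) * q ^ (n + 1) = -q * (-q) ^ n := by
      rw [← mul_pow, neg_one_mul, pow_succ, mul_comm]
    linear_combination ((-1 : ℂ) ^ (n + 1)) * h +
      2 * (√Real.pi : ℝ) * Complex.exp (-(I * (x : ℂ) ^ 2)) * hsq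
  have hexp : Complex.exp (I * (x : ℂ) ^ 2) * Complex.exp (-(I * (x : ℂ) ^ 2)) = 1 := by
    rw [← Complex.exp_add, add_neg_cancel, Complex.exp_zero]
  simp_rw [hterm]
  rw [hgeo.summable.tsum_sub hT, hgeo.tsum_eq, F_sub_FN_eq N hx, ← hq, sub_neg_eq_add]
  generalize ∑' n : ℕ, (-1 : ℂ) ^ (n + 1) * fourierTerm x ((n + 1) * A N) = T
  field_simp
  linear_combination (2 * (√Real.pi : ℝ) * q) * hexp

/-! ### Bounds for the tail and for the series -/

lemma rho_norm {x : ℝ} (hx : 0 ≤ x) : ‖rho x‖ = x := by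
  have h : -(I * Real.pi / 4) = ((-(Real.pi / 4) : ℝ) : ℂ) * I := by push_cast; ring
  rw [rho, h, norm_mul, Complex.norm_exp_ofReal_mul_I, Complex.norm_real, Real.norm_of_nonneg hx,
    mul_one]

lemma norm_tail_le (N : ℕ) {x : ℝ} (hx : 0 < x) :
    ‖tail N x‖ ≤ (2 * Real.pi + 1) / (2 * Real.pi * √(x ^ 4 + A N ^ 4)) *
      Real.exp (-(A N) ^ 2) := by
  have hpi := Real.pi_pos
  have hA := A_pos N
  have hr : Real.exp (-(2 * Real.pi)) < 1 := by rw [Real.exp_lt_one_iff]; linarith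
  have hg := (hasSum_geometric_of_lt_one (Real.exp_pos _).le hr).mul_left
    (Real.exp (-(A N) ^ 2) / √(x ^ 4 + A N ^ 4))
  have hle : ‖tail N x‖ ≤ Real.exp (-(A N) ^ 2) / √(x ^ 4 + A N ^ 4) *
      (1 - Real.exp (-(2 * Real.pi)))⁻¹ := by
    refine tsum_of_norm_bounded hg fun n => ?_
    have hn : (0 : ℝ) ≤ n := Nat.cast_nonneg n
    have ht : A N ≤ A N + n * (Real.pi / A N) := by
      have : 0 ≤ n * (Real.pi / A N) := by positivity
      linarith
    rw [norm_integrand, ← Real.exp_nat_mul, div_mul_eq_mul_div, ← Real.exp_add]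
    have hsq : -(A N + n * (Real.pi / A N)) ^ 2 ≤ -(A N) ^ 2 + n * -(2 * Real.pi) := by
      have h1 : (A N + n * (Real.pi / A N)) ^ 2 =
          A N ^ 2 + n * (2 * Real.pi) + (n * (Real.pi / A N)) ^ 2 := by field_simp; ring
      rw [h1]
      nlinarith [sq_nonneg (n * (Real.pi / A N))]
    gcongr
  -- `e^{2π} ≥ 1 + 2π` bounds the geometric series
  have hgeo : (1 - Real.exp (-(2 * Real.pi)))⁻¹ ≤ (2 * Real.pi + 1) / (2 * Real.pi) := by
    have h1 : Real.exp (-(2 * Real.pi)) ≤ 1 / (2 * Real.pi + 1) := by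
      rw [Real.exp_neg, ← one_div]
      exact one_div_le_one_div_of_le (by positivity) (Real.add_one_le_exp _)
    have h2 : 2 * Real.pi / (2 * Real.pi + 1) ≤ 1 - Real.exp (-(2 * Real.pi)) := by
      have : 2 * Real.pi / (2 * Real.pi + 1) = 1 - 1 / (2 * Real.pi + 1) := by field_simp; ring
      linarith
    rw [← inv_div]
    exact inv_anti₀ (by positivity) h2
  calc ‖tail N x‖ ≤ Real.exp (-(A N) ^ 2) / √(x ^ 4 + A N ^ 4) *
      (1 - Real.exp (-(2 * Real.pi)))⁻¹ := hle
    _ ≤ Real.exp (-(A N) ^ 2) / √(x ^ 4 + A N ^ 4) * ((2 * Real.pi + 1) / (2 * Real.pi)) := by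
      gcongr
    _ = _ := by field_simp

lemma norm_tail_term_le (N : ℕ) {x : ℝ} (hx : 0 < x) :
    ‖I * rho x * Complex.exp (I * (x : ℂ) ^ 2) / A N * tail N x‖ ≤
      (2 * Real.pi + 1) * x / (2 * Real.pi * A N * √(x ^ 4 + (A N) ^ 4)) *
        Real.exp (-(A N) ^ 2) := by
  have hA := A_pos N
  rw [norm_mul, norm_div, norm_mul, norm_mul, Complex.norm_I, rho_norm hx.le, norm_exp_I_mul_sq,
    Complex.norm_real, Real.norm_of_nonneg hA.le]
  calc 1 * x * 1 / A N * ‖tail N x‖ ≤ 1 * x * 1 / A N *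
      ((2 * Real.pi + 1) / (2 * Real.pi * √(x ^ 4 + A N ^ 4)) * Real.exp (-(A N) ^ 2)) := by
        gcongr
        exact norm_tail_le N hx
    _ = _ := by
      have : 0 < √(x ^ 4 + A N ^ 4) := by positivity
      field_simp

/-- An alternating series whose terms decay like `e^{-(2m-1)α²}`, `m = n + 1`. -/
lemma norm_alternating_series_le {u : ℕ → ℂ} {α B : ℝ} (hα : 0 < α) (x : ℝ)
    (hu : ∀ n : ℕ, ‖u n‖ ≤ Real.exp (α ^ 2 - 2 * α * ((n + 1) * α)) * B) :
    ‖Complex.exp (I * (x : ℂ) ^ 2) / (2 * (√Real.pi : ℝ)) *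
        ∑' n : ℕ, (-1) ^ (n + 1) * u n‖ ≤
      Real.exp (-α ^ 2) / (1 - Real.exp (-2 * α ^ 2)) * B / (2 * √Real.pi) := by
  have hs := (hasSum_exp_sub (mul_pos hα hα)).mul_right B
  have h1 : α ^ 2 - 2 * α * α = -α ^ 2 := by ring
  have h2 : -2 * (α * α) = -2 * α ^ 2 := by ring
  rw [h1, h2] at hs
  have hle : ‖∑' n : ℕ, (-1) ^ (n + 1) * u n‖ ≤
      Real.exp (-α ^ 2) / (1 - Real.exp (-2 * α ^ 2)) * B := by
    refine tsum_of_norm_bounded hs fun n => ?_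
    rw [norm_mul, norm_pow, norm_neg, norm_one, one_pow, one_mul]
    exact hu n
  rw [norm_mul, norm_div, norm_exp_I_mul_sq, norm_mul, Complex.norm_real, Complex.norm_ofNat,
    Real.norm_of_nonneg (Real.sqrt_nonneg _), one_div_mul_eq_div]
  gcongr

lemma norm_pole_term_le {x α : ℝ} (hx : 0 < x) (hα : 0 < α) :
    ‖Complex.exp (-2 * α * rho x) / (1 + Complex.exp (-2 * α * rho x))‖ ≤
      Real.exp (-(√2 * α * x)) / (1 - Real.exp (-(√2 * α * x))) := by
  have h1 := norm_exp_neg_two_mul_rho_lt_one hx hα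
  rw [norm_div, ← norm_exp_neg_two_mul_rho]
  have h2 := norm_sub_norm_le (1 : ℂ) (-Complex.exp (-2 * α * rho x))
  rw [norm_neg, norm_one, sub_neg_eq_add] at h2
  have h3 : 0 < 1 - ‖Complex.exp (-2 * α * rho x)‖ := by linarith
  gcongr

/-! ### The pole-free terms when the pole is below the line of height `A_N` -/

/-- On the diagonal `|sinh (u - iu)| ≤ √2 sinh u`. -/
lemma norm_exp_sub_exp_neg_le {u : ℝ} (hu : 0 ≤ u) :
    ‖Complex.exp (u - u * I) - Complex.exp (-(u - u * I))‖ ≤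
      √2 * (Real.exp u - Real.exp (-u)) := by
  have h1 : Complex.exp (u - u * I) - Complex.exp (-(u - u * I)) =
      (((Real.exp u - Real.exp (-u)) * Real.cos u : ℝ) : ℂ) +
        ((-(Real.exp u + Real.exp (-u)) * Real.sin u : ℝ) : ℂ) * I := by
    have e1 : (u : ℂ) - u * I = u + (-u : ℂ) * I := by ring
    have e2 : -((u : ℂ) - u * I) = -u + u * I := by ring
    rw [e2, e1, Complex.exp_add, Complex.exp_add, Complex.exp_mul_I, Complex.exp_mul_I,
      Complex.cos_neg, Complex.sin_neg]
    push_cast; ring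
  have hsinh : 2 * u ≤ Real.exp u - Real.exp (-u) := by
    have := Real.self_le_sinh_iff.mpr hu
    rw [Real.sinh_eq] at this
    linarith
  have hsin : (2 * Real.sin u) ^ 2 ≤ (Real.exp u - Real.exp (-u)) ^ 2 := by
    rw [sq_le_sq]
    have h3 : |Real.sin u| ≤ |u| := Real.abs_sin_le_abs
    rw [abs_mul, abs_two, abs_of_nonneg (by linarith : 0 ≤ Real.exp u - Real.exp (-u))]
    rw [abs_of_nonneg hu] at h3
    linarith
  have hee : Real.exp u * Real.exp (-u) = 1 := by
    rw [← Real.exp_add, add_neg_cancel, Real.exp_zero]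
  rw [h1, Complex.norm_add_mul_I]
  apply Real.sqrt_le_iff.mpr
  refine ⟨mul_nonneg (Real.sqrt_nonneg _) (by linarith), ?_⟩
  rw [mul_pow √2, Real.sq_sqrt (by norm_num)]
  have hcs := Real.sin_sq_add_cos_sq u
  have key : ((Real.exp u - Real.exp (-u)) * Real.cos u) ^ 2 +
      (-(Real.exp u + Real.exp (-u)) * Real.sin u) ^ 2 =
      (Real.exp u - Real.exp (-u)) ^ 2 + (2 * Real.sin u) ^ 2 := by
    linear_combination (Real.exp u - Real.exp (-u)) ^ 2 * hcs + 4 * Real.sin u ^ 2 * hee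
  rw [key]
  linarith

lemma norm_gaussLaplace_sub_le {x α c : ℝ} (hx : 0 < x) (hα : x / √2 < α) (hc : α ≤ c) :
    ‖gaussLaplace (c - rho x) - gaussLaplace (c + rho x)‖ ≤
      √2 * (1 / (α - x / √2) - 1 / (α + x / √2)) := by
  set a := x / √2 with ha
  have ha0 : 0 < a := by positivity
  have hI1 : IntegrableOn (fun s : ℝ => Real.exp (-(α - a) * s)) (Ioi 0) :=
    integrableOn_exp_mul_Ioi (by linarith) 0
  have hI2 : IntegrableOn (fun s : ℝ => Real.exp (-(α + a) * s)) (Ioi 0) :=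
    integrableOn_exp_mul_Ioi (by linarith) 0
  have h1 : ∫ s in Ioi (0 : ℝ), Real.exp (-(α - a) * s) = 1 / (α - a) := by
    rw [integral_exp_mul_Ioi (by linarith)]; simp [-neg_sub, div_eq_mul_inv]
  have h2 : ∫ s in Ioi (0 : ℝ), Real.exp (-(α + a) * s) = 1 / (α + a) := by
    rw [integral_exp_mul_Ioi (by linarith), mul_zero, Real.exp_zero, neg_div_neg_eq]
  rw [← h1, ← h2, ← integral_sub hI1 hI2, ← integral_const_mul, gaussLaplace, gaussLaplace,
    ← integral_sub (integrable_gaussKernel _).integrableOn (integrable_gaussKernel _).integrableOn]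
  refine norm_integral_le_of_norm_le ((hI1.sub hI2).const_mul _) ?_
  filter_upwards [ae_restrict_mem measurableSet_Ioi] with s hs
  have hs : (0 : ℝ) < s := hs
  have hk : gaussKernel (c - rho x) s - gaussKernel (c + rho x) s =
      gaussKernel c s * (Complex.exp ((a * s : ℝ) - (a * s : ℝ) * I) -
        Complex.exp (-((a * s : ℝ) - (a * s : ℝ) * I))) := by
    rw [gaussKernel, gaussKernel, gaussKernel, mul_sub, ← Complex.exp_add, ← Complex.exp_add,
      rho_eq, ← ha]
    congr 2 <;> (push_cast; ring)
  have hb : ‖gaussKernel c s‖ ≤ Real.exp (-α * s) := by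
    rw [norm_gaussKernel, Complex.ofReal_re]
    apply Real.exp_le_exp.mpr
    nlinarith [sq_nonneg s]
  rw [hk, norm_mul]
  calc _ ≤ Real.exp (-α * s) * (√2 * (Real.exp (a * s) - Real.exp (-(a * s)))) :=
        mul_le_mul hb (norm_exp_sub_exp_neg_le (by positivity)) (norm_nonneg _) (Real.exp_pos _).le
    _ = _ := by
      have e1 : Real.exp (-(α - a) * s) = Real.exp (-α * s) * Real.exp (a * s) := by
        rw [← Real.exp_add]; congr 1; ring
      have e2 : Real.exp (-(α + a) * s) = Real.exp (-α * s) * Real.exp (-(a * s)) := by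
        rw [← Real.exp_add]; congr 1; ring
      rw [e1, e2]; ring

lemma norm_poleFreeTerm_le_of_lt {x α c : ℝ} (hx : 0 < x) (hα : x / √2 < α) (hc : α ≤ c) :
    ‖poleFreeTerm x c‖ ≤ Real.exp (α ^ 2 - 2 * α * c) *
      (√2 * (1 / (α - x / √2) - 1 / (α + x / √2))) := by
  rw [poleFreeTerm, norm_mul, norm_exp_neg_sq]
  exact mul_le_mul (exp_neg_sq_le c α) (norm_gaussLaplace_sub_le hx hα hc) (norm_nonneg _)
    (Real.exp_pos _).le

/-! ### The pole-free terms when the pole is close to the line of height `A_N` -/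

lemma norm_poleFreeTerm_le_of_le {x α c : ℝ} (hx : 0 < x) (hα : 0 < α) (hc : α ≤ c)
    (hxc : x / √2 ≤ c) :
    ‖poleFreeTerm x c‖ ≤ Real.exp (α ^ 2 - 2 * α * c) * (2 / (x / √2) + 1 / (α + x / √2)) := by
  have ha0 : 0 < x / √2 := by positivity
  have hre : ((c : ℂ) - rho x).re = c - x / √2 := by simp [rho_re]
  have him : ((c : ℂ) - rho x).im = x / √2 := by simp [rho_im]
  have hre2 : ((c : ℂ) + rho x).re = c + x / √2 := by simp [rho_re]
  have hn : x / √2 ≤ ‖(c : ℂ) - rho x‖ := by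
    have := Complex.abs_im_le_norm ((c : ℂ) - rho x)
    rwa [him, abs_of_pos ha0] at this
  have h1 : ‖gaussLaplace (c - rho x)‖ ≤ 2 / (x / √2) := by
    refine (norm_gaussLaplace_le (by rw [hre]; linarith) ?_).trans ?_
    · exact norm_pos_iff.mp (ha0.trans_le hn)
    · gcongr
  have h2 : ‖gaussLaplace (c + rho x)‖ ≤ 1 / (α + x / √2) := by
    refine (norm_gaussLaplace_le_inv_re (by rw [hre2]; linarith)).trans ?_
    rw [hre2]; gcongr
  rw [poleFreeTerm, norm_mul, norm_exp_neg_sq]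
  exact mul_le_mul (exp_neg_sq_le c α) ((norm_sub_le _ _).trans (add_le_add h1 h2)) (norm_nonneg _)
    (Real.exp_pos _).le

/-- When the pole lies above, the reflection formula for `gaussLaplace` moves it below at the cost
of one residue, which is of order `e^{-2α²}`. -/
lemma norm_poleFreeTerm_le_of_ge {x α : ℝ} (hα : 0 < α) (hxα : α ≤ x / √2) :
    ‖poleFreeTerm x α‖ ≤ Real.exp (α ^ 2 - 2 * α * α) *
      (2 / (x / √2) + 1 / (α + x / √2) + 2 * √Real.pi * Real.exp (-α ^ 2)) := by
  have ha0 : 0 < x / √2 := hα.trans_le hxα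
  have hre : (rho x - (α : ℂ)).re = x / √2 - α := by simp [rho_re]
  have him : (rho x - (α : ℂ)).im = -(x / √2) := by simp [rho_im]
  have hre2 : (rho x + (α : ℂ)).re = x / √2 + α := by simp [rho_re]
  have hn : x / √2 ≤ ‖rho x - (α : ℂ)‖ := by
    have := Complex.abs_im_le_norm (rho x - (α : ℂ))
    rwa [him, abs_neg, abs_of_pos ha0] at this
  have h1 : ‖gaussLaplace (rho x - α)‖ ≤ 2 / (x / √2) := by
    refine (norm_gaussLaplace_le (by rw [hre]; linarith) ?_).trans ?_
    · exact norm_pos_iff.mp (ha0.trans_le hn)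
    · gcongr
  have h2 : ‖gaussLaplace (rho x + α)‖ ≤ 1 / (α + x / √2) := by
    refine (norm_gaussLaplace_le_inv_re (by rw [hre2]; linarith)).trans ?_
    rw [hre2, add_comm]
  have h3 : ‖fourierTerm x α‖ ≤ Real.exp (-α ^ 2) * (2 / (x / √2) + 1 / (α + x / √2)) := by
    rw [fourierTerm, norm_mul, norm_exp_neg_sq]
    gcongr
    exact (norm_add_le _ _).trans (add_le_add h1 h2)
  have h4 : ‖2 * ((√Real.pi : ℝ) : ℂ) *
      (Complex.exp (-(I * (x : ℂ) ^ 2)) * Complex.exp (-2 * α * rho x))‖ ≤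
      Real.exp (-α ^ 2) * (2 * √Real.pi * Real.exp (-α ^ 2)) := by
    have hu : ‖Complex.exp (-(I * (x : ℂ) ^ 2))‖ = 1 := by
      rw [Complex.exp_neg, norm_inv, norm_exp_I_mul_sq, inv_one]
    have hx2 : x = √2 * (x / √2) := by field_simp
    have h2 : √2 * √2 = 2 := Real.mul_self_sqrt (by norm_num)
    have hq : Real.exp (-(√2 * α * x)) ≤ Real.exp (-α ^ 2) * Real.exp (-α ^ 2) := by
      rw [← Real.exp_add]
      apply Real.exp_le_exp.mpr
      have : √2 * α * x = 2 * α * (x / √2) := by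
        nth_rewrite 1 [hx2]; linear_combination (α * (x / √2)) * h2
      rw [this]; nlinarith
    rw [norm_mul, norm_mul, norm_mul, hu, norm_exp_neg_two_mul_rho, Complex.norm_real,
      Complex.norm_ofNat, Real.norm_of_nonneg (Real.sqrt_nonneg _), one_mul]
    calc 2 * √Real.pi * Real.exp (-(√2 * α * x))
        ≤ 2 * √Real.pi * (Real.exp (-α ^ 2) * Real.exp (-α ^ 2)) := by gcongr
      _ = _ := by ring
  have h5 : poleFreeTerm x α = 2 * ((√Real.pi : ℝ) : ℂ) *
      (Complex.exp (-(I * (x : ℂ) ^ 2)) * Complex.exp (-2 * α * rho x)) - fourierTerm x α := by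
    rw [← fourierTerm_add_poleFreeTerm]; ring
  rw [h5, show α ^ 2 - 2 * α * α = -α ^ 2 by ring]
  refine (norm_sub_le _ _).trans ((add_le_add h4 h3).trans_eq ?_)
  ring

lemma norm_poleFreeTerm_le_of_near {x α : ℝ} (hα : 0 < α) (hx : 0 < x) (hxα : x / √2 ≤ 2 * α)
    (n : ℕ) :
    ‖poleFreeTerm x ((n + 1) * α)‖ ≤ Real.exp (α ^ 2 - 2 * α * ((n + 1) * α)) *
      (2 / (x / √2) + 1 / (α + x / √2) + 2 * √Real.pi * Real.exp (-α ^ 2)) := by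
  have hn : (0 : ℝ) ≤ n := Nat.cast_nonneg n
  by_cases h : x / √2 ≤ (n + 1) * α
  · refine (norm_poleFreeTerm_le_of_le hx hα (by nlinarith) h).trans ?_
    refine mul_le_mul_of_nonneg_left ?_ (Real.exp_pos _).le
    have : 0 ≤ 2 * √Real.pi * Real.exp (-α ^ 2) := by positivity
    linarith
  · have hn0 : n = 0 := by
      by_contra hne
      have : (1 : ℝ) ≤ n := by exact_mod_cast Nat.one_le_iff_ne_zero.mpr hne
      apply h
      nlinarith
    subst hn0
    push_cast at h ⊢
    rw [zero_add, one_mul] at h ⊢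
    exact norm_poleFreeTerm_le_of_ge hα (not_le.mp h).le

/-! ### The pointwise error bound -/

lemma one_sub_exp_pos (N : ℕ) : 0 < 1 - Real.exp (-2 * (A N) ^ 2) := by
  have h : Real.exp (-2 * (A N) ^ 2) < 1 := by
    rw [Real.exp_lt_one_iff]
    nlinarith [pow_pos (A_pos N) 2]
  linarith

lemma two_le_A {N : ℕ} (hN : 1 ≤ N) : 2 ≤ A N := by
  have h1 : (1 : ℝ) ≤ N := by exact_mod_cast hN
  apply Real.le_sqrt_of_sq_le
  nlinarith [Real.pi_gt_three]

lemma A_mul_exp_neg_sq_le {N : ℕ} (hN : 1 ≤ N) : A N * Real.exp (-(A N) ^ 2) ≤ 1 / 6 := by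
  have hA := two_le_A hN
  have h := Real.quadratic_le_exp_of_nonneg (sq_nonneg (A N))
  rw [Real.exp_neg, ← div_eq_mul_inv, div_le_iff₀ (Real.exp_pos _)]
  have h2 : (4 : ℝ) ≤ A N ^ 2 := by nlinarith
  have h3 : 2 * A N ^ 2 ≤ (A N ^ 2) ^ 2 / 2 := by nlinarith
  nlinarith

lemma norm_sub_le_of_far_below (N : ℕ) {x : ℝ} (hx : 0 < x) (h : x / √2 ≤ 3 / 4 * A N) :
    ‖Complex.exp (I * (x : ℂ) ^ 2) / (2 * (√Real.pi : ℝ)) *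
        ∑' n : ℕ, (-1) ^ (n + 1) * poleFreeTerm x ((n + 1) * A N)‖ ≤ Δ N x := by
  have hA := A_pos N
  have hd := one_sub_exp_pos N
  have hpi : 0 < √Real.pi := Real.sqrt_pos.mpr Real.pi_pos
  have hlt : x / √2 < A N := by linarith
  refine (norm_alternating_series_le hA x fun n => norm_poleFreeTerm_le_of_lt hx hlt ?_).trans_eq ?_
  · nlinarith [(Nat.cast_nonneg n : (0 : ℝ) ≤ n)]
  rw [Δ, if_pos h]
  have ha0 : 0 < x / √2 := by positivity
  have hxa : x = √2 * (x / √2) := by field_simp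
  have hx2 : x ^ 2 / 2 = (x / √2) ^ 2 := by
    rw [div_pow, Real.sq_sqrt (by norm_num)]
  rw [hx2]
  nth_rewrite 3 [hxa]
  generalize x / √2 = a at *
  have h1 : 0 < A N - a := by linarith
  have h3 : 0 < A N + a := by linarith
  have h4 : A N ^ 2 - a ^ 2 = (A N - a) * (A N + a) := by ring
  rw [h4]
  field_simp
  ring

lemma norm_sub_le_of_near {N : ℕ} (hN : 1 ≤ N) {x : ℝ} (hx : 0 < x) (h : 3 / 4 * A N < x / √2)
    (h' : x / √2 < 5 / 4 * A N) :
    ‖Complex.exp (I * (x : ℂ) ^ 2) / (2 * (√Real.pi : ℝ)) *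
        ∑' n : ℕ, (-1) ^ (n + 1) * poleFreeTerm x ((n + 1) * A N)‖ ≤ Δ N x := by
  have hA := A_pos N
  have hd := one_sub_exp_pos N
  have hpi : 0 < √Real.pi := Real.sqrt_pos.mpr Real.pi_pos
  have hpi2 : √Real.pi ≤ 9 / 5 := by
    rw [Real.sqrt_le_left (by norm_num)]; linarith [Real.pi_lt_d2]
  have hs2 : (7 / 5 : ℝ) ≤ √2 := Real.le_sqrt_of_sq_le (by norm_num)
  have hE := A_mul_exp_neg_sq_le hN
  have hxa : x = √2 * (x / √2) := by field_simp
  refine (norm_alternating_series_le hA x fun n => norm_poleFreeTerm_le_of_near hA hx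
    (by linarith) n).trans ?_
  rw [Δ, if_neg (not_le.mpr h), if_pos h']
  generalize x / √2 = a at *
  set E := Real.exp (-(A N) ^ 2)
  have hE0 : 0 < E := Real.exp_pos _
  set b := Real.exp (-β * (A N) ^ 2)
  have hb0 : 0 < b := Real.exp_pos _
  set d := 1 - Real.exp (-2 * (A N) ^ 2)
  have ha0 : 0 < a := by linarith
  -- in units of `A N` this reads `1 + 1/a + 1/2 + √π A E (1 + a) ≤ 4√2 a` for `a ≥ 3/4`
  have key : (2 / a + 1 / (A N + a) + 2 * √Real.pi * E) / 2 ≤ 4 * √2 * a / (A N * (A N + a)) := by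
    rw [le_div_iff₀ (by positivity)]
    have e1 : (2 / a + 1 / (A N + a) + 2 * √Real.pi * E) / 2 * (A N * (A N + a)) =
        A N * (A N / a) + A N + A N / 2 + √Real.pi * (A N * E) * (A N + a) := by
      field_simp
    have e2 : A N / a ≤ 4 / 3 := by rw [div_le_iff₀ ha0]; linarith
    have e3 : √Real.pi * (A N * E) ≤ 9 / 5 * (1 / 6) :=
      mul_le_mul hpi2 hE (by positivity) (by norm_num)
    have e4 : √Real.pi * (A N * E) * (A N + a) ≤ 9 / 5 * (1 / 6) * (A N + a) := by gcongr
    have e5 : A N * (A N / a) ≤ A N * (4 / 3) := by gcongr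
    have e6 : 4 * (7 / 5) * a ≤ 4 * √2 * a := by gcongr
    rw [e1]
    linarith
  calc E / d * (2 / a + 1 / (A N + a) + 2 * √Real.pi * E) / (2 * √Real.pi)
      = E / (d * √Real.pi) * ((2 / a + 1 / (A N + a) + 2 * √Real.pi * E) / 2) := by field_simp
    _ ≤ E / (d * √Real.pi) * (4 * √2 * a / (A N * (A N + a)) * (1 + 2 * √Real.pi * b)) := by
      gcongr
      refine key.trans (le_mul_of_one_le_right (by positivity) ?_)
      have : 0 ≤ 2 * √Real.pi * b := by positivity
      linarith
    _ = _ := by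
      rw [hxa]; field_simp

lemma norm_sub_le_of_far_above (N : ℕ) {x : ℝ} (hx : 0 < x) (h : 5 / 4 * A N ≤ x / √2) :
    ‖Complex.exp (-2 * A N * rho x) / (1 + Complex.exp (-2 * A N * rho x))‖ +
      ‖Complex.exp (I * (x : ℂ) ^ 2) / (2 * (√Real.pi : ℝ)) *
        ∑' n : ℕ, (-1) ^ (n + 1) * fourierTerm x ((n + 1) * A N)‖ ≤ Δ N x := by
  have hA := A_pos N
  have hd := one_sub_exp_pos N
  have hpi : 0 < √Real.pi := Real.sqrt_pos.mpr Real.pi_pos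
  have hs2 : (1 : ℝ) ≤ √2 := Real.le_sqrt_of_sq_le (by norm_num)
  have hlt : A N < x / √2 := by linarith
  rw [Δ, if_neg (by linarith), if_neg (not_lt.mpr h), add_comm]
  refine add_le_add ?_ (norm_pole_term_le hx hA)
  refine (norm_alternating_series_le hA x fun n => norm_fourierTerm_le hA.le hlt ?_).trans ?_
  · nlinarith [(Nat.cast_nonneg n : (0 : ℝ) ≤ n)]
  have ha0 : 0 < x / √2 := by positivity
  have hxa : x / √2 ≤ x := div_le_self hx.le hs2
  have hx2 : x ^ 2 / 2 = (x / √2) ^ 2 := by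
    rw [div_pow, Real.sq_sqrt (by norm_num)]
  rw [hx2]
  generalize x / √2 = a at *
  have h1 : 0 < a - A N := by linarith
  have h3 : 0 < a + A N := by linarith
  have h4 : a ^ 2 - A N ^ 2 = (a - A N) * (a + A N) := by ring
  rw [h4]
  set E := Real.exp (-(A N) ^ 2)
  have hE0 : 0 < E := Real.exp_pos _
  set d := 1 - Real.exp (-2 * (A N) ^ 2)
  calc E / d * (1 / (a - A N) + 1 / (a + A N)) / (2 * √Real.pi)
      = a * E / (√Real.pi * ((a - A N) * (a + A N)) * d) := by field_simp; ring
    _ ≤ _ := by gcongr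

theorem norm_F_sub_FN_le_of_pos {N : ℕ} (hN : 1 ≤ N) {x : ℝ} (hx : 0 < x) :
    ‖F x - FN N x‖ ≤ η N x := by
  rw [η, abs_of_pos hx, add_comm]
  rcases lt_or_ge (x / √2) (5 / 4 * A N) with h | h
  · rw [F_sub_FN_eq_poleFree N hx]
    refine (norm_add_le _ _).trans (add_le_add (norm_tail_term_le N hx) ?_)
    rcases le_or_gt (x / √2) (3 / 4 * A N) with h' | h'
    · exact norm_sub_le_of_far_below N hx h'
    · exact norm_sub_le_of_near hN hx h' h
  · rw [F_sub_FN_eq N hx, sub_sub]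
    refine (norm_sub_le _ _).trans (add_le_add (norm_tail_term_le N hx) ?_)
    exact (norm_add_le _ _).trans (norm_sub_le_of_far_above N hx h)

theorem norm_F_sub_FN_le {N : ℕ} (hN : 1 ≤ N) (x : ℝ) : ‖F x - FN N x‖ ≤ η N x := by
  rcases lt_trichotomy x 0 with hx | rfl | hx
  · have h := norm_F_sub_FN_le_of_pos hN (neg_pos.mpr hx)
    rw [F_neg, FN_neg, sub_sub_sub_cancel_left, norm_sub_rev] at h
    rwa [η, abs_neg, (by decide : Even 4).neg_pow] at h
  · have hF : F 0 = 1 / 2 := by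
      have := F_neg 0
      rw [neg_zero] at this
      linear_combination this / 2
    have hFN : FN N 0 = 1 / 2 := by simp [FN]
    have hη : η N 0 = 0 := by simp [η, Δ, (A_pos N).le]
    rw [hF, hFN, hη, sub_self, norm_zero]
  · exact norm_F_sub_FN_le_of_pos hN hx

/-! ### The uniform bound -/

lemma sqrt_two_bounds : (1.41421 : ℝ) < √2 ∧ √2 < 1.41422 := by
  constructor
  · exact Real.lt_sqrt_of_sq_lt (by norm_num)
  · rw [Real.sqrt_lt' (by norm_num)]; norm_num

lemma β_eq : β = 15 / 16 - 5 / 8 * √2 := by rw [β]; ring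

lemma β_bounds : (0.0536125 : ℝ) < β ∧ β < 0.05361875 := by
  have := sqrt_two_bounds
  rw [β_eq]
  constructor <;> linarith

lemma Δ_le (N : ℕ) {x : ℝ} (hx : 0 ≤ x) :
    Δ N x ≤ 20 * √2 / (9 * √Real.pi * A N * (1 - Real.exp (-2 * (A N) ^ 2))) *
      (1 + 2 * √Real.pi * Real.exp (-β * (A N) ^ 2)) * Real.exp (-(A N) ^ 2) := by
  have hA := A_pos N
  have hd := one_sub_exp_pos N
  have hpi : 0 < √Real.pi := Real.sqrt_pos.mpr Real.pi_pos
  have hs2 := sqrt_two_bounds.1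
  have hxa : x = √2 * (x / √2) := by field_simp
  have hx2 : x ^ 2 / 2 = (x / √2) ^ 2 := by
    rw [div_pow, Real.sq_sqrt (by norm_num)]
  have ha0 : 0 ≤ x / √2 := by positivity
  have h2 : √2 * √2 = 2 := Real.mul_self_sqrt (by norm_num)
  have hexp : √2 * A N * x = 2 * A N * (x / √2) := by
    nth_rewrite 1 [hxa]; linear_combination (A N * (x / √2)) * h2
  rw [Δ, hx2, hexp]
  generalize x / √2 = a at *
  subst hxa
  set E := Real.exp (-(A N) ^ 2) with hE
  have hE0 : 0 < E := Real.exp_pos _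
  set b := Real.exp (-β * (A N) ^ 2) with hb
  have hb0 : 0 < b := Real.exp_pos _
  set d := 1 - Real.exp (-2 * (A N) ^ 2) with hdd
  have hb1 : 1 ≤ 1 + 2 * √Real.pi * b := by
    have : 0 ≤ 2 * √Real.pi * b := by positivity
    linarith
  set κ := E / (√Real.pi * d) with hκ
  have hκ0 : 0 < κ := by positivity
  have hR : 20 * √2 / (9 * √Real.pi * A N * d) * (1 + 2 * √Real.pi * b) * E =
      κ * (√2 * (20 / (9 * A N))) * (1 + 2 * √Real.pi * b) := by rw [hκ]; field_simp
  rw [hR]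
  split_ifs with h h'
  · have h1 : 0 < A N ^ 2 - a ^ 2 :=
      sub_pos.mpr (pow_lt_pow_left₀ (by linarith) ha0 two_ne_zero)
    have h3 : a / (A N ^ 2 - a ^ 2) ≤ 20 / (9 * A N) := by
      rw [div_le_div_iff₀ h1 (by positivity)]
      linarith [mul_le_mul_of_nonneg_right h hA.le, mul_le_mul_of_nonneg_left h ha0,
        sq_nonneg (A N)]
    calc √2 * a * E / (√Real.pi * (A N ^ 2 - a ^ 2) * d)
        = κ * (√2 * (a / (A N ^ 2 - a ^ 2))) := by rw [hκ]; field_simp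
      _ ≤ κ * (√2 * (20 / (9 * A N))) := by gcongr
      _ ≤ _ := le_mul_of_one_le_right (by positivity) hb1
  · have h3 : 4 * a / (A N * (A N + a)) ≤ 20 / (9 * A N) := by
      rw [div_le_div_iff₀ (by positivity) (by positivity)]
      nlinarith only [mul_lt_mul_of_pos_right h' hA]
    calc 4 * (√2 * a) * E * (1 + 2 * √Real.pi * b) / (√Real.pi * A N * (A N + a) * d)
        = κ * (√2 * (4 * a / (A N * (A N + a)))) * (1 + 2 * √Real.pi * b) := by
          rw [hκ]; field_simp
      _ ≤ _ := by gcongr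
  · have h'' : 5 / 4 * A N ≤ a := not_lt.mp h'
    have h1 : 0 < a ^ 2 - A N ^ 2 :=
      sub_pos.mpr (pow_lt_pow_left₀ (by linarith) hA.le two_ne_zero)
    have h3 : a / (a ^ 2 - A N ^ 2) ≤ 20 / (9 * A N) := by
      rw [div_le_div_iff₀ h1 (by positivity)]
      linear_combination 4 *
        mul_nonneg (sub_nonneg.mpr h'') (by positivity : 0 ≤ 5 * a + 4 * A N)
    have h3' : 5 / 4 * A N * A N ≤ a * A N := by gcongr
    have h4 : √2 * a * E / (√Real.pi * (a ^ 2 - A N ^ 2) * d) ≤ κ * (√2 * (20 / (9 * A N))) := by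
      calc √2 * a * E / (√Real.pi * (a ^ 2 - A N ^ 2) * d)
        = κ * (√2 * (a / (a ^ 2 - A N ^ 2))) := by rw [hκ]; field_simp
      _ ≤ κ * (√2 * (20 / (9 * A N))) := by gcongr
    -- `2 A a ≥ (5/2) A² ≥ (1 + β + 1) A²`, and the last `e^{-A²}` absorbs the factor `A`
    have h5 : Real.exp (-(2 * A N * a)) ≤ E * b * Real.exp (-(A N) ^ 2) := by
      rw [hE, hb, ← Real.exp_add, ← Real.exp_add]
      apply Real.exp_le_exp.mpr
      have hβ : β * A N ^ 2 ≤ 1 / 2 * A N ^ 2 := by gcongr; linarith [β_bounds.2]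
      linarith
    have h6 : d ≤ 1 - Real.exp (-(2 * A N * a)) := by
      rw [hdd]
      have : Real.exp (-(2 * A N * a)) ≤ Real.exp (-2 * A N ^ 2) := by
        apply Real.exp_le_exp.mpr
        linarith [sq_nonneg (A N)]
      linarith
    have h7 : Real.exp (-(A N) ^ 2) ≤ √2 * (20 / (9 * A N)) * 2 := by
      have e1 : Real.exp (-(A N) ^ 2) ≤ 1 / (A N ^ 2 + 1) := by
        rw [Real.exp_neg, ← one_div]
        exact one_div_le_one_div_of_le (by positivity) (Real.add_one_le_exp _)
      have e2 : 1 / (A N ^ 2 + 1) ≤ 20 / (9 * A N) := by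
        rw [div_le_div_iff₀ (by positivity) (by positivity)]
        linarith [sq_nonneg (A N - 1), sq_nonneg (A N)]
      have e3 : 0 < 20 / (9 * A N) := by positivity
      have e4 : 1 * (20 / (9 * A N)) ≤ √2 * (20 / (9 * A N)) := by gcongr; linarith
      linarith
    have h8 : Real.exp (-(2 * A N * a)) / (1 - Real.exp (-(2 * A N * a))) ≤
        κ * (√2 * (20 / (9 * A N))) * (2 * √Real.pi * b) := by
      calc _ ≤ E * b * Real.exp (-(A N) ^ 2) / d := by gcongr
        _ ≤ E * b * (√2 * (20 / (9 * A N)) * 2) / d := by gcongr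
        _ = _ := by rw [hκ]; field_simp
    rw [mul_add, mul_one]
    exact add_le_add h4 h8

lemma rate_eq (N : ℕ) :
    Real.exp (-Real.pi * N) / √((N : ℝ) + 1 / 2) =
      √Real.pi * Real.exp (Real.pi / 2) * Real.exp (-(A N) ^ 2) / A N := by
  have hpi : 0 < √Real.pi := Real.sqrt_pos.mpr Real.pi_pos
  have h1 : A N = √((N : ℝ) + 1 / 2) * √Real.pi := Real.sqrt_mul (by positivity) _
  have h2 : 0 < √((N : ℝ) + 1 / 2) := Real.sqrt_pos.mpr (by positivity)
  have h3 : Real.exp (Real.pi / 2) * Real.exp (-(A N) ^ 2) = Real.exp (-Real.pi * N) := by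
    rw [← Real.exp_add, A_sq]; congr 1; ring
  rw [mul_assoc, h3, h1]
  field_simp

lemma pi_rpow_three_halves : Real.pi ^ (3 / 2 : ℝ) = Real.pi * √Real.pi := by
  rw [show (3 / 2 : ℝ) = 1 + 1 / 2 by norm_num, Real.rpow_add Real.pi_pos, Real.rpow_one,
    Real.sqrt_eq_rpow]

theorem η_le (N : ℕ) (x : ℝ) :
    η N x ≤ c N * (Real.exp (-Real.pi * (N : ℝ)) / √((N : ℝ) + 1 / 2)) := by
  have hA := A_pos N
  have hd := one_sub_exp_pos N
  have hp0 := Real.pi_pos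
  have hpi : 0 < √Real.pi := Real.sqrt_pos.mpr Real.pi_pos
  have hpi2 : √Real.pi * √Real.pi = Real.pi := Real.mul_self_sqrt hp0.le
  have hee : Real.exp (-Real.pi / 2) * Real.exp (Real.pi / 2) = 1 := by
    rw [← Real.exp_add, neg_div, neg_add_cancel, Real.exp_zero]
  have hη : η N x = Δ N |x| + (2 * Real.pi + 1) / (2 * Real.pi * A N) *
      (|x| / √(|x| ^ 4 + A N ^ 4)) * Real.exp (-(A N) ^ 2) := by
    have : |x| ^ 4 = x ^ 4 := (by decide : Even 4).pow_abs x
    rw [η, this]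
    have : 0 < √(x ^ 4 + A N ^ 4) := Real.sqrt_pos.mpr (by positivity)
    field_simp
  have hamgm : |x| / √(|x| ^ 4 + A N ^ 4) ≤ 1 / (√2 * A N) := by
    have hs : 0 < √(|x| ^ 4 + A N ^ 4) := Real.sqrt_pos.mpr (by positivity)
    rw [div_le_div_iff₀ hs (by positivity), one_mul]
    apply Real.le_sqrt_of_sq_le
    rw [mul_pow, mul_pow, Real.sq_sqrt (by norm_num)]
    nlinarith [sq_nonneg (|x| ^ 2 - A N ^ 2)]
  have hΔ := Δ_le N (abs_nonneg x)
  rw [hη, rate_eq, c, pi_rpow_three_halves]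
  set E := Real.exp (-(A N) ^ 2)
  have hE0 : 0 < E := Real.exp_pos _
  set b := Real.exp (-β * (A N) ^ 2)
  set d := 1 - Real.exp (-2 * (A N) ^ 2)
  set e := Real.exp (-Real.pi / 2)
  set f := Real.exp (Real.pi / 2)
  set s := √Real.pi
  rw [← hpi2] at hp0 ⊢
  have hcalc : (20 * √2 * e / (9 * (s * s) * d) * (1 + 2 * s * b) +
      (2 * (s * s) + 1) * e / (2 * √2 * (s * s * s) * A N)) * (s * f * E / A N) =
      (e * f) * (20 * √2 / (9 * s * A N * d) * (1 + 2 * s * b) * E +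
        (2 * (s * s) + 1) / (2 * (s * s) * A N) * (1 / (√2 * A N)) * E) := by
    field_simp
  rw [hcalc, hee, one_mul]
  gcongr

/-! ### The constants `c_N` -/

lemma A_lt {m n : ℕ} (h : m < n) : A m < A n := by
  have : (m : ℝ) < n := by exact_mod_cast h
  apply Real.sqrt_lt_sqrt (by positivity)
  have := Real.pi_pos
  gcongr

theorem strictAnti_c : StrictAnti c := by
  intro m n hmn
  have hlt := A_lt hmn
  have hm := A_pos m
  have hn := A_pos n
  have hd := one_sub_exp_pos m
  have hp0 := Real.pi_pos
  have hsq : A m ^ 2 ≤ A n ^ 2 := by gcongr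
  have h1 : Real.exp (-2 * A n ^ 2) ≤ Real.exp (-2 * A m ^ 2) :=
    Real.exp_le_exp.mpr (by linarith)
  have h2 : Real.exp (-β * A n ^ 2) ≤ Real.exp (-β * A m ^ 2) :=
    Real.exp_le_exp.mpr (by nlinarith [β_bounds.1])
  have hdn := one_sub_exp_pos n
  rw [c, c]
  apply add_lt_add_of_le_of_lt
  · gcongr
  · gcongr

lemma tendsto_A : Tendsto A atTop atTop := by
  refine Real.tendsto_sqrt_atTop.comp (Tendsto.atTop_mul_const Real.pi_pos ?_)
  exact tendsto_atTop_add_const_right _ _ tendsto_natCast_atTop_atTop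

theorem tendsto_c :
    Tendsto c atTop (𝓝 (20 * √2 * Real.exp (-Real.pi / 2) / (9 * Real.pi))) := by
  have hp0 := Real.pi_pos
  have hsq : Tendsto (fun N => A N ^ 2) atTop atTop :=
    (tendsto_pow_atTop (by norm_num)).comp tendsto_A
  have hexp : ∀ k : ℝ, k < 0 → Tendsto (fun N => Real.exp (k * A N ^ 2)) atTop (𝓝 0) :=
    fun k hk => Real.tendsto_exp_atBot.comp (hsq.const_mul_atTop_of_neg hk)
  have h1 := hexp (-2) (by norm_num)
  have h2 := hexp (-β) (by linarith [β_bounds.1])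
  have h3 : Tendsto (fun N => 20 * √2 * Real.exp (-Real.pi / 2) /
      (9 * Real.pi * (1 - Real.exp (-2 * A N ^ 2)))) atTop
      (𝓝 (20 * √2 * Real.exp (-Real.pi / 2) / (9 * Real.pi * (1 - 0)))) :=
    tendsto_const_nhds.div ((h1.const_sub 1).const_mul _) (by positivity)
  have h4 : Tendsto (fun N => 1 + 2 * √Real.pi * Real.exp (-β * A N ^ 2)) atTop
      (𝓝 (1 + 2 * √Real.pi * 0)) := (h2.const_mul _).const_add 1
  have h5 : Tendsto (fun N => (2 * Real.pi + 1) * Real.exp (-Real.pi / 2) /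
      (2 * √2 * Real.pi ^ (3 / 2 : ℝ) * A N)) atTop (𝓝 0) :=
    tendsto_const_nhds.div_atTop (tendsto_A.const_mul_atTop (by positivity))
  have h := (h3.mul h4).add h5
  simp only [sub_zero, mul_zero, add_zero, mul_one] at h
  exact h

/-! ### Numerical values -/

lemma exp_neg_pi_div_two_bounds :
    (0.20786 : ℝ) < Real.exp (-Real.pi / 2) ∧ Real.exp (-Real.pi / 2) < 0.2079 := by
  have hl := Real.pi_gt_d6
  have hu := Real.pi_lt_d6
  have hsq : Real.exp (-Real.pi / 2) = Real.exp (-(Real.pi / 4)) ^ 2 := by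
    rw [← Real.exp_nat_mul]; congr 1; push_cast; ring
  have b1 := Real.exp_bound (x := -0.785398) (by norm_num [abs_le]) (n := 8) (by norm_num)
  have b2 := Real.exp_bound (x := -0.78539825) (by norm_num [abs_le]) (n := 8) (by norm_num)
  rw [abs_le] at b1 b2
  norm_num [Finset.sum_range_succ, Nat.factorial] at b1 b2
  have l : (0.45593 : ℝ) < Real.exp (-(Real.pi / 4)) := by
    refine lt_of_lt_of_le ?_ (Real.exp_le_exp.mpr (by linarith : -0.78539825 ≤ -(Real.pi / 4)))
    norm_num
    linarith [b2.1]
  have u : Real.exp (-(Real.pi / 4)) < (0.45595 : ℝ) := by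
    refine lt_of_le_of_lt (Real.exp_le_exp.mpr (by linarith : -(Real.pi / 4) ≤ -0.785398)) ?_
    norm_num
    linarith [b1.2]
  rw [hsq]
  constructor <;> nlinarith

lemma exp_neg_β_bounds :
    (0.7767 : ℝ) < Real.exp (-β * (A 1) ^ 2) ∧ Real.exp (-β * (A 1) ^ 2) < 0.7768 := by
  have hl := Real.pi_gt_d6
  have hu := Real.pi_lt_d6
  obtain ⟨hβl, hβu⟩ := β_bounds
  have hA : A 1 ^ 2 = 3 / 2 * Real.pi := by rw [A_sq]; push_cast; ring
  have b1 := Real.exp_bound (x := -0.25263) (by norm_num [abs_le]) (n := 6) (by norm_num)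
  have b2 := Real.exp_bound (x := -0.2527) (by norm_num [abs_le]) (n := 6) (by norm_num)
  rw [abs_le] at b1 b2
  norm_num [Finset.sum_range_succ, Nat.factorial] at b1 b2
  rw [hA]
  constructor
  · refine lt_of_lt_of_le ?_ (Real.exp_le_exp.mpr
      (by nlinarith : -0.2527 ≤ -β * (3 / 2 * Real.pi)))
    norm_num
    linarith [b2.1]
  · refine lt_of_le_of_lt (Real.exp_le_exp.mpr
      (by nlinarith : -β * (3 / 2 * Real.pi) ≤ -0.25263)) ?_
    norm_num
    linarith [b1.2]

lemma limit_bounds :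
    (0.2079 : ℝ) < 20 * √2 * Real.exp (-Real.pi / 2) / (9 * Real.pi) ∧
      20 * √2 * Real.exp (-Real.pi / 2) / (9 * Real.pi) < 0.208 := by
  have hl := Real.pi_gt_d6
  have hu := Real.pi_lt_d6
  obtain ⟨h1, h2⟩ := exp_neg_pi_div_two_bounds
  obtain ⟨s1, s2⟩ := sqrt_two_bounds
  have hp0 := Real.pi_pos
  constructor
  · rw [lt_div_iff₀ (by positivity)]
    nlinarith
  · rw [div_lt_iff₀ (by positivity)]
    nlinarith

theorem abs_c_one_sub_lt : |c 1 - 0.825| < 0.0005 := by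
  have hl := Real.pi_gt_d6
  have hu := Real.pi_lt_d6
  have hp0 := Real.pi_pos
  obtain ⟨e1, e2⟩ := exp_neg_pi_div_two_bounds
  obtain ⟨b1, b2⟩ := exp_neg_β_bounds
  obtain ⟨k1, k2⟩ := limit_bounds
  have p1 : (1.77245 : ℝ) < √Real.pi := Real.lt_sqrt_of_sq_lt (by norm_num; linarith)
  have p2 : √Real.pi < 1.77246 := by
    rw [Real.sqrt_lt' (by norm_num)]; norm_num; linarith
  have r1 : (1.73205 : ℝ) < √3 := Real.lt_sqrt_of_sq_lt (by norm_num)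
  have r2 : √3 < 1.73206 := by
    rw [Real.sqrt_lt' (by norm_num)]; norm_num
  have hd : Real.exp (-2 * A 1 ^ 2) = Real.exp (-Real.pi / 2) ^ 6 := by
    rw [← Real.exp_nat_mul, A_sq]; congr 1; push_cast; ring
  have hd1 : 0 < Real.exp (-2 * A 1 ^ 2) := Real.exp_pos _
  have hd2 : Real.exp (-2 * A 1 ^ 2) < 0.0001 := by
    rw [hd]
    calc Real.exp (-Real.pi / 2) ^ 6 ≤ (0.2079 : ℝ) ^ 6 := by gcongr
      _ < 0.0001 := by norm_num
  have hden : 2 * √2 * Real.pi ^ (3 / 2 : ℝ) * A 1 = 2 * √3 * Real.pi ^ 2 := by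
    have hA : A 1 = √3 * √Real.pi / √2 := by
      rw [A, ← Real.sqrt_mul (by norm_num), ← Real.sqrt_div (by positivity)]
      congr 1; push_cast; ring
    have := Real.mul_self_sqrt hp0.le
    rw [pi_rpow_three_halves, hA]
    field_simp
    linear_combination this
  have t1 : 0.0442 < (2 * Real.pi + 1) * Real.exp (-Real.pi / 2) / (2 * √3 * Real.pi ^ 2) := by
    rw [lt_div_iff₀ (by positivity)]
    have : √3 * Real.pi ^ 2 < 1.73206 * 3.141593 ^ 2 := by gcongr
    nlinarith
  have t2 : (2 * Real.pi + 1) * Real.exp (-Real.pi / 2) / (2 * √3 * Real.pi ^ 2) < 0.0443 := by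
    rw [div_lt_iff₀ (by positivity)]
    have : 1.73205 * 3.141592 ^ 2 < √3 * Real.pi ^ 2 := by gcongr
    nlinarith
  have hc : c 1 = 20 * √2 * Real.exp (-Real.pi / 2) / (9 * Real.pi) /
      (1 - Real.exp (-2 * A 1 ^ 2)) * (1 + 2 * √Real.pi * Real.exp (-β * A 1 ^ 2)) +
      (2 * Real.pi + 1) * Real.exp (-Real.pi / 2) / (2 * √3 * Real.pi ^ 2) := by
    rw [c, hden, div_div]
  rw [hc]
  generalize 20 * √2 * Real.exp (-Real.pi / 2) / (9 * Real.pi) = k at *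
  generalize (2 * Real.pi + 1) * Real.exp (-Real.pi / 2) / (2 * √3 * Real.pi ^ 2) = t at *
  generalize Real.exp (-2 * A 1 ^ 2) = q at *
  generalize Real.exp (-β * A 1 ^ 2) = b at *
  have q1 : k ≤ k / (1 - q) := by
    rw [le_div_iff₀ (by linarith)]; nlinarith
  have q2 : k / (1 - q) ≤ k * 1.00011 := by
    rw [div_le_iff₀ (by linarith)]; nlinarith
  have m1 : 1.77245 * 0.7767 ≤ √Real.pi * b := by gcongr
  have m2 : √Real.pi * b ≤ 1.77246 * 0.7768 := by gcongr
  rw [abs_lt]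
  constructor <;> nlinarith

end Fresnel

theorem theorem3 :
    -- the improper integral that defines `F` converges
    (∀ x : ℝ, ∃ L : ℂ,
      Filter.Tendsto (fun R : ℝ => ∫ t in x..R, Complex.exp (Complex.I * (t : ℂ) ^ 2))
        Filter.atTop (nhds L)) ∧
    -- the error bounds
    (∀ N : ℕ, 1 ≤ N → ∀ x : ℝ,
      ‖Fresnel.F x - Fresnel.FN N x‖ ≤ Fresnel.η N x ∧
      Fresnel.η N x ≤
        Fresnel.c N * (Real.exp (-Real.pi * (N : ℝ)) / Real.sqrt ((N : ℝ) + 1 / 2))) ∧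
    -- `c_N` decreases, with `c_1 ≈ 0.825` and limit `20√2 e^{-π/2}/(9π) ≈ 0.208`
    StrictAntiOn Fresnel.c (Set.Ici 1) ∧
    |Fresnel.c 1 - 0.825| < 0.0005 ∧
    Filter.Tendsto Fresnel.c Filter.atTop
      (nhds (20 * Real.sqrt 2 * Real.exp (-Real.pi / 2) / (9 * Real.pi))) ∧
    |20 * Real.sqrt 2 * Real.exp (-Real.pi / 2) / (9 * Real.pi) - 0.208| < 0.0005 ∧
    -- exponential convergence, uniformly on the real line
    (∃ C : ℝ, 0 < C ∧ ∀ N : ℕ, 1 ≤ N → ∀ x : ℝ,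
      ‖Fresnel.F x - Fresnel.FN N x‖ ≤ C * Real.exp (-Real.pi * (N : ℝ))) := by
  obtain ⟨k1, k2⟩ := Fresnel.limit_bounds
  have hc1 : 0 < Fresnel.c 1 := by
    have := (abs_lt.mp Fresnel.abs_c_one_sub_lt).1
    linarith
  refine ⟨fun x => ⟨_, Fresnel.tendsto_fresnel_integral x⟩,
    fun N hN x => ⟨Fresnel.norm_F_sub_FN_le hN x, Fresnel.η_le N x⟩,
    Fresnel.strictAnti_c.strictAntiOn _, Fresnel.abs_c_one_sub_lt, Fresnel.tendsto_c, ?_,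
    Fresnel.c 1, hc1, fun N hN x => ?_⟩
  · rw [abs_lt]
    constructor <;> linarith
  · refine (Fresnel.norm_F_sub_FN_le hN x).trans ((Fresnel.η_le N x).trans ?_)
    have h1 : (1 : ℝ) ≤ Real.sqrt ((N : ℝ) + 1 / 2) := by
      have : (1 : ℝ) ≤ N := by exact_mod_cast hN
      apply Real.le_sqrt_of_sq_le
      linarith
    exact mul_le_mul (Fresnel.strictAnti_c.antitone hN) (div_le_self (Real.exp_pos _).le h1)
      (by positivity) hc1.le
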